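/- Let $k$ be a field. Paths are composed from left to right. A \emph{bound quiver algebra} is $kQ/I$ with $Q$ a finite quiver and $I$ an admissible ideal of the path algebra $kQ$: every path occurring (with nonzero coefficient) in an element of $I$ has length at least $2$, and for some $N>1$ all paths of length $N$ lie in $I$. For a set $A$ of arrows and $z\in kQ$ write $z=z_A+z_{\not A}$, where $z_A$ is a combination of paths passing through some arrow of $A$ and $z_{\not A}$ is a combination of paths avoiding all arrows of $A$. The set $A$ is \emph{pre-removable} in $kQ/I$ if $z_A,z_{\not A}\in I$ for every $z\in I$. For $k$-algebras $\Gamma,\Lambda$, $\Gamma$ is an \emph{arrow pre-removal} of $\Lambda$ if there are a bound quiver algebra $kQ/I\simeq\Lambda$ and a set of arrows $A$ (possibly empty), pre-removable in $kQ/I$, with $\Gamma\simeq (kQ/I)/\langle A+I\rangle$, where $\langle A+I\rangle$ is the two-sided ideal of $kQ/I$ generated by the classes of the arrows in $A$. A \emph{multiplicative bimodule} over a finite-dimensional $k$-algebra $\Gamma$ is a pair $(M,\theta)$ where $M$ is a (possibly zero) $\Gamma$-bimodule, finite-dimensional over $k$ and with $k$ acting centrally, and $\theta\colon M\otimes_\Gamma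 M\to M$ is an associative homomorphism of $\Gamma$-bimodules. It is \emph{nilpotent} if $\theta^N=0$ for some positive integer $N$, where $\theta^0=\mathrm{id}_M$ and $\theta^r=\theta\circ(\theta^{r-1}\otimes 1_M)\colon M^{\otimes_\Gamma(r+1)}\to M$. The \emph{split extension} $\Gamma\ltimes_\theta M$ is the $k$-algebra $\Gamma\oplus M$ with multiplication $(\gamma_1,m_1)(\gamma_2,m_2)=(\gamma_1\gamma_2,\ \gamma_1m_2+m_1\gamma_2+\theta(m_1\otimes m_2))$. All isomorphisms below are isomorphisms of $k$-algebras. (1) Let $\Gamma=kQ_\Gamma/I_\Gamma$ be a bound quiver algebra and $(M,\theta)$ a multiplicative $\Gamma$-bimodule. Then $\Gamma\ltimes_\theta M$ is isomorphic to a bound quiver algebra whose quiver has the same number of vertices as $Q_\Gamma$ if and only if $(M,\theta)$ is nilpotent. Furthermore, in that case $\Gamma$ is an arrow pre-removal of $\Gamma\ltimes_\theta M$. (2) Let $\Gamma$ and $\Lambda$ be basic finite-dimensional $k$-algebras all of whose simple modules are one-dimensional over $k$. The following are equivalent: (i) $\Gamma$ is an arrow pre-removal of $\Lambda$; (ii)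 $\Gamma$ is isomorphic to a split algebra quotient of $\Lambda$ over a superfluous ideal, i.e. to $\Lambda/K$ for a two-sided ideal $K$ contained in the Jacobson radical of $\Lambda$ such that the natural epimorphism $\Lambda\to\Lambda/K$ has a section that is a $k$-algebra homomorphism; (iii) $\Lambda$ is isomorphic to a split extension $\Gamma\ltimes_\theta M$ of $\Gamma$ by a nilpotent multiplicative bimodule $(M,\theta)$. -/

import Mathlib

universe u v w x

/-! ### Path algebras -/

/-- The paths of a quiver, with arbitrary source and target, trivial paths included. -/
abbrev QuiverPath (V : Type u) [Quiver.{v} V] : Type (max u v) :=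
  Σ a b : V, Quiver.Path a b

/-- The path algebra `k Q`: the vector space with basis the set of all paths. -/
def PathAlgebra (k : Type w) [Field k] (V : Type u) [Quiver.{v} V] : Type (max u v w) :=
  QuiverPath V →₀ k

namespace PathAlgebra

section

variable (k : Type w) [Field k] (V : Type u) [Quiver.{v} V]

noncomputable instance : AddCommGroup (PathAlgebra k V) :=
  inferInstanceAs (AddCommGroup (QuiverPath V →₀ k))

noncomputable instance : Module k (PathAlgebra k V) :=
  inferInstanceAs (Module k (QuiverPath V →₀ k))

end

section

variable (k : Type w) [Field k] {V : Type u} [Quiver.{v} V]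

/-- The basis element given by a path. -/
noncomputable def ofPath {a b : V} (p : Quiver.Path a b) : PathAlgebra k V :=
  Finsupp.single (⟨a, b, p⟩ : QuiverPath V) (1 : k)

/-- The basis of `k Q` consisting of all paths. -/
noncomputable def pathBasis (V : Type u) [Quiver.{v} V] :
    Module.Basis (QuiverPath V) k (PathAlgebra k V) :=
  ⟨LinearEquiv.refl k (QuiverPath V →₀ k)⟩

theorem pathBasis_apply {a b : V} (p : Quiver.Path a b) :
    pathBasis k V ⟨a, b, p⟩ = ofPath k p := rfl

open Classical in
/-- The product of two paths: the path `p` followed by the path `q` if `p` ends where `q` starts,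
and zero otherwise. -/
noncomputable def pathMul (p q : QuiverPath V) : PathAlgebra k V :=
  if h : p.2.1 = q.1 then ofPath k (p.2.2.comp (q.2.2.cast h.symm rfl)) else 0

/-- The bilinear extension of the product of paths. -/
noncomputable def mulHom : PathAlgebra k V →ₗ[k] PathAlgebra k V →ₗ[k] PathAlgebra k V :=
  (pathBasis k V).constr k fun p => (pathBasis k V).constr k fun q => pathMul k p q

variable {k}

/-- The coefficient of a path. A path occurs in `z` if its coefficient is nonzero. -/
noncomputable def coeff (z : PathAlgebra k V) {a b : V} (p : Quiver.Path a b) : k :=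
  (pathBasis k V).repr z ⟨a, b, p⟩

noncomputable instance : Mul (PathAlgebra k V) := ⟨fun f g => mulHom k f g⟩

theorem mul_def (f g : PathAlgebra k V) : f * g = mulHom k f g := rfl

theorem mulHom_ofPath {a b c d : V} (p : Quiver.Path a b) (q : Quiver.Path c d) :
    mulHom k (ofPath k p) (ofPath k q) = pathMul k ⟨a, b, p⟩ ⟨c, d, q⟩ := by
  rw [mulHom, ← pathBasis_apply, ← pathBasis_apply, Module.Basis.constr_basis,
    Module.Basis.constr_basis]

theorem ofPath_mul_ofPath {a b c : V} (p : Quiver.Path a b) (q : Quiver.Path b c) :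
    ofPath k p * ofPath k q = ofPath k (p.comp q) := by
  rw [mul_def, mulHom_ofPath]
  simp [pathMul]

theorem ofPath_mul_ofPath_of_ne {a b c d : V} (p : Quiver.Path a b) (q : Quiver.Path c d)
    (h : b ≠ c) : ofPath k p * ofPath k q = 0 := by
  rw [mul_def, mulHom_ofPath]
  simp [pathMul, h]

theorem induction_on {P : PathAlgebra k V → Prop} (z : PathAlgebra k V) (zero : P 0)
    (add : ∀ x y, P x → P y → P (x + y))
    (smul : ∀ (c : k) {a b : V} (p : Quiver.Path a b), P (c • ofPath k p)) : P z := by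
  refine Finsupp.induction_linear z zero add ?_
  rintro ⟨a, b, p⟩ c
  have h : c • ofPath k p = Finsupp.single (⟨a, b, p⟩ : QuiverPath V) c := by
    refine (Finsupp.smul_single c _ _).trans ?_
    rw [smul_eq_mul, mul_one]
  exact h ▸ smul c p

protected theorem add_mul (x y z : PathAlgebra k V) : (x + y) * z = x * z + y * z := by
  simp [mul_def]

protected theorem mul_add (x y z : PathAlgebra k V) : x * (y + z) = x * y + x * z := by
  simp [mul_def]

protected theorem smul_mul (c : k) (x y : PathAlgebra k V) : (c • x) * y = c • (x * y) := by
  simp [mul_def]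

protected theorem mul_smul (c : k) (x y : PathAlgebra k V) : x * (c • y) = c • (x * y) := by
  simp [mul_def]

protected theorem zero_mul (x : PathAlgebra k V) : 0 * x = 0 := by
  simp [mul_def]

protected theorem mul_zero (x : PathAlgebra k V) : x * 0 = 0 := by
  simp [mul_def]

protected theorem mul_assoc (x y z : PathAlgebra k V) : x * y * z = x * (y * z) := by
  induction x using induction_on with
  | zero => simp only [PathAlgebra.zero_mul]
  | add x₁ x₂ h₁ h₂ => simp only [PathAlgebra.add_mul, h₁, h₂]
  | smul c p =>
    induction y using induction_on with
    | zero => simp only [PathAlgebra.zero_mul, PathAlgebra.mul_zero]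
    | add y₁ y₂ h₁ h₂ => simp only [PathAlgebra.add_mul, PathAlgebra.mul_add, h₁, h₂]
    | smul d q =>
      induction z using induction_on with
      | zero => simp only [PathAlgebra.mul_zero]
      | add z₁ z₂ h₁ h₂ => simp only [PathAlgebra.mul_add, h₁, h₂]
      | smul e r =>
        simp only [PathAlgebra.smul_mul, PathAlgebra.mul_smul]
        congr 3
        rename_i a b a' b' a'' b''
        by_cases h : b = a'
        · subst h
          by_cases h' : b' = a''
          · subst h'
            simp only [ofPath_mul_ofPath, Quiver.Path.comp_assoc]
          · rw [ofPath_mul_ofPath, ofPath_mul_ofPath_of_ne _ _ h', ofPath_mul_ofPath_of_ne _ _ h',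
              PathAlgebra.mul_zero]
        · rw [ofPath_mul_ofPath_of_ne _ _ h, PathAlgebra.zero_mul]
          by_cases h' : b' = a''
          · subst h'
            rw [ofPath_mul_ofPath, ofPath_mul_ofPath_of_ne _ _ h]
          · rw [ofPath_mul_ofPath_of_ne _ _ h', PathAlgebra.mul_zero]

variable [Fintype V]

/-- The unit is the sum of the trivial paths. -/
noncomputable instance : One (PathAlgebra k V) :=
  ⟨∑ a : V, ofPath k (Quiver.Path.nil : Quiver.Path a a)⟩

theorem one_def :
    (1 : PathAlgebra k V) = ∑ a : V, ofPath k (Quiver.Path.nil : Quiver.Path a a) := rfl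

protected theorem one_mul (x : PathAlgebra k V) : 1 * x = x := by
  induction x using induction_on with
  | zero => exact PathAlgebra.mul_zero _
  | add x₁ x₂ h₁ h₂ => rw [PathAlgebra.mul_add, h₁, h₂]
  | smul c p =>
    rename_i a b
    rw [PathAlgebra.mul_smul, one_def, mul_def, map_sum, LinearMap.sum_apply,
      Finset.sum_eq_single a]
    · rw [← mul_def, ofPath_mul_ofPath, Quiver.Path.nil_comp]
    · intro d _ hd
      rw [← mul_def, ofPath_mul_ofPath_of_ne _ _ hd]
    · simp

protected theorem mul_one (x : PathAlgebra k V) : x * 1 = x := by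
  induction x using induction_on with
  | zero => exact PathAlgebra.zero_mul _
  | add x₁ x₂ h₁ h₂ => rw [PathAlgebra.add_mul, h₁, h₂]
  | smul c p =>
    rename_i a b
    rw [PathAlgebra.smul_mul, one_def, mul_def, map_sum, Finset.sum_eq_single b]
    · rw [← mul_def, ofPath_mul_ofPath, Quiver.Path.comp_nil]
    · intro d _ hd
      rw [← mul_def, ofPath_mul_ofPath_of_ne _ _ hd.symm]
    · simp

noncomputable instance : Ring (PathAlgebra k V) where
  __ := (inferInstance : AddCommGroup (PathAlgebra k V))
  zero_mul := PathAlgebra.zero_mul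
  mul_zero := PathAlgebra.mul_zero
  left_distrib := PathAlgebra.mul_add
  right_distrib := PathAlgebra.add_mul
  mul_assoc := PathAlgebra.mul_assoc
  one_mul := PathAlgebra.one_mul
  mul_one := PathAlgebra.mul_one

noncomputable instance : Algebra k (PathAlgebra k V) :=
  Algebra.ofModule PathAlgebra.smul_mul PathAlgebra.mul_smul

end

end PathAlgebra

/-! ### Bound quiver algebras and pre-removable sets of arrows -/

/-- A two-sided ideal of the path algebra is admissible if every path occurring in it has length
at least two and, for some `N > 1`, it contains all paths of length `N`. -/
structure IsAdmissible {k : Type w} [Field k] {V : Type u} [Quiver.{v} V] [Fintype V]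
    (I : Ideal (PathAlgebra k V)) : Prop where
  two_le_length : ∀ z ∈ I, ∀ (a b : V) (p : Quiver.Path a b), z.coeff p ≠ 0 → 2 ≤ p.length
  exists_length : ∃ N : ℕ, 1 < N ∧
    ∀ (a b : V) (p : Quiver.Path a b), p.length = N → PathAlgebra.ofPath k p ∈ I

/-- A finite quiver together with an admissible ideal of its path algebra over `k`. -/
structure BoundQuiver (k : Type w) [Field k] where
  /-- the set of vertices -/
  V : Type u
  [quiver : Quiver.{v} V]
  [fintypeVertices : Fintype V]
  [finiteArrows : ∀ a b : V, Finite (a ⟶ b)]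
  /-- the ideal of relations -/
  I : Ideal (PathAlgebra k V)
  [isTwoSided : I.IsTwoSided]
  admissible : IsAdmissible I

namespace BoundQuiver

attribute [instance] BoundQuiver.quiver BoundQuiver.fintypeVertices BoundQuiver.finiteArrows
  BoundQuiver.isTwoSided

variable {k : Type w} [Field k]

/-- The bound quiver algebra `k Q / I`. -/
abbrev algebra (B : BoundQuiver.{u, v, w} k) : Type (max u v w) :=
  PathAlgebra k B.V ⧸ B.I

end BoundQuiver

/-- A path passes through (some arrow of) a set of arrows `A` if `p = p₁ α p₂` for some paths
`p₁`, `p₂` and some `α` in `A`. -/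
def PassesThrough {V : Type u} [Quiver.{v} V] (A : Set (Quiver.Total V)) {a b : V}
    (p : Quiver.Path a b) : Prop :=
  ∃ α ∈ A, ∃ (p₁ : Quiver.Path a α.left) (p₂ : Quiver.Path α.right b),
    p = (p₁.cons α.hom).comp p₂

namespace PathAlgebra

variable {k : Type w} [Field k] {V : Type u} [Quiver.{v} V]

open Classical in
/-- The component `z_A` of `z` in the span of the paths passing through `A`. -/
noncomputable def through (A : Set (Quiver.Total V)) (z : PathAlgebra k V) : PathAlgebra k V :=
  (pathBasis k V).repr.symm
    (Finsupp.filter (fun p => PassesThrough A p.2.2) ((pathBasis k V).repr z))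

open Classical in
/-- The component of `z` in the span of the paths avoiding `A`. -/
noncomputable def avoiding (A : Set (Quiver.Total V)) (z : PathAlgebra k V) : PathAlgebra k V :=
  (pathBasis k V).repr.symm
    (Finsupp.filter (fun p => ¬ PassesThrough A p.2.2) ((pathBasis k V).repr z))

theorem through_add_avoiding (A : Set (Quiver.Total V)) (z : PathAlgebra k V) :
    through A z + avoiding A z = z := by
  classical
  rw [through, avoiding, ← map_add, Finsupp.filter_add_filter_not, LinearEquiv.symm_apply_apply]

end PathAlgebra

namespace BoundQuiver

variable {k : Type w} [Field k]

/-- A set of arrows `A` is pre-removable in `k Q / I` if for every `z ∈ I` the components of `z`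
through `A` and avoiding `A` both belong to `I`. -/
def IsPreRemovable (B : BoundQuiver.{u, v, w} k) (A : Set (Quiver.Total B.V)) : Prop :=
  ∀ z ∈ B.I, PathAlgebra.through A z ∈ B.I ∧ PathAlgebra.avoiding A z ∈ B.I

/-- The two-sided ideal `⟨A + I⟩` of `k Q / I` generated by the classes of the arrows in `A`. -/
noncomputable def arrowIdeal (B : BoundQuiver.{u, v, w} k) (A : Set (Quiver.Total B.V)) :
    Ideal B.algebra :=
  (TwoSidedIdeal.span
    {x : B.algebra | ∃ α ∈ A,
      x = Ideal.Quotient.mk B.I (PathAlgebra.ofPath k α.hom.toPath)}).asIdeal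

instance (B : BoundQuiver.{u, v, w} k) (A : Set (Quiver.Total B.V)) :
    (B.arrowIdeal A).IsTwoSided :=
  inferInstanceAs ((TwoSidedIdeal.asIdeal _).IsTwoSided)

end BoundQuiver

/-- `Γ` is an arrow pre-removal algebra of `Λ`: for some representation `k Q / I` of `Λ` as a
bound quiver algebra and some pre-removable set of arrows `A` in it, `Γ` is isomorphic to the
quotient of `k Q / I` by the ideal generated by `A`. -/
def IsArrowPreRemoval (k : Type w) [Field k] (Γ : Type u) [Ring Γ] [Algebra k Γ]
    (Λ : Type v) [Ring Λ] [Algebra k Λ] : Prop :=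
  ∃ B : BoundQuiver.{0, 0, w} k, Nonempty (Λ ≃ₐ[k] B.algebra) ∧
    ∃ A : Set (Quiver.Total B.V), B.IsPreRemovable A ∧
      Nonempty (Γ ≃ₐ[k] (B.algebra ⧸ B.arrowIdeal A))

/-! ### Multiplicative bimodules and split extensions -/

/-- A multiplicative structure on a `Γ`-bimodule `M`, i.e. an associative homomorphism of
`Γ`-bimodules `θ : M ⊗_Γ M → M`. By the universal property of the tensor product over the
noncommutative ring `Γ`, it is given as the `Γ`-balanced biadditive map `θ m n = θ (m ⊗ n)`.
The zero bimodule is allowed. -/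
structure MultiplicativeBimodule (Γ : Type u) [Ring Γ] (M : Type v) [AddCommGroup M]
    [Module Γ M] [Module Γᵐᵒᵖ M] [SMulCommClass Γ Γᵐᵒᵖ M] where
  /-- the map `θ` -/
  θ : M →+ M →+ M
  balanced : ∀ (γ : Γ) (m n : M), θ (MulOpposite.op γ • m) n = θ m (γ • n)
  map_smul_left : ∀ (γ : Γ) (m n : M), θ (γ • m) n = γ • θ m n
  map_smul_right : ∀ (γ : Γ) (m n : M),
    θ m (MulOpposite.op γ • n) = MulOpposite.op γ • θ m n
  assoc : ∀ l m n : M, θ (θ l m) n = θ l (θ m n)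

namespace MultiplicativeBimodule

variable {Γ : Type u} [Ring Γ] {M : Type v} [AddCommGroup M]
  [Module Γ M] [Module Γᵐᵒᵖ M] [SMulCommClass Γ Γᵐᵒᵖ M]

/-- The value of `θ ^ r : M ^ {⊗ (r + 1)} → M` on the pure tensor `x 0 ⊗ ⋯ ⊗ x r`, where
`θ ^ 0 = id` and `θ ^ (r + 1) = θ ∘ (θ ^ r ⊗ 1)`. -/
def iter (T : MultiplicativeBimodule Γ M) : ℕ → (ℕ → M) → M
  | 0, x => x 0
  | r + 1, x => T.θ (T.iter r x) (x (r + 1))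

/-- `(M, θ)` is nilpotent if `θ ^ N = 0` for some positive integer `N`. -/
def IsNilpotent (T : MultiplicativeBimodule Γ M) : Prop :=
  ∃ N : ℕ, 0 < N ∧ ∀ x : ℕ → M, T.iter N x = 0

end MultiplicativeBimodule

/-- The underlying additive group `Γ ⊕ M` of the split extension `Γ ⋉_θ M`. -/
def SplitExtension {Γ : Type u} [Ring Γ] {M : Type v} [AddCommGroup M]
    [Module Γ M] [Module Γᵐᵒᵖ M] [SMulCommClass Γ Γᵐᵒᵖ M]
    (_T : MultiplicativeBimodule Γ M) : Type (max u v) :=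
  Γ × M

namespace SplitExtension

variable {Γ : Type u} [Ring Γ] {M : Type v} [AddCommGroup M]
  [Module Γ M] [Module Γᵐᵒᵖ M] [SMulCommClass Γ Γᵐᵒᵖ M] (T : MultiplicativeBimodule Γ M)

instance : AddCommGroup (SplitExtension T) := inferInstanceAs (AddCommGroup (Γ × M))

/-- `(γ₁, m₁) (γ₂, m₂) = (γ₁ γ₂, γ₁ m₂ + m₁ γ₂ + θ (m₁ ⊗ m₂))`. -/
instance : Mul (SplitExtension T) :=
  ⟨fun x y => (x.1 * y.1, x.1 • y.2 + MulOpposite.op y.1 • x.2 + T.θ x.2 y.2)⟩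

instance : One (SplitExtension T) := ⟨((1 : Γ), (0 : M))⟩

variable {T}

@[ext] theorem ext {x y : SplitExtension T} (h₁ : x.1 = y.1) (h₂ : x.2 = y.2) : x = y :=
  Prod.ext h₁ h₂

@[simp] theorem fst_zero : (0 : SplitExtension T).1 = 0 := rfl
@[simp] theorem snd_zero : (0 : SplitExtension T).2 = 0 := rfl
@[simp] theorem fst_one : (1 : SplitExtension T).1 = 1 := rfl
@[simp] theorem snd_one : (1 : SplitExtension T).2 = 0 := rfl
@[simp] theorem fst_add (x y : SplitExtension T) : (x + y).1 = x.1 + y.1 := rfl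
@[simp] theorem snd_add (x y : SplitExtension T) : (x + y).2 = x.2 + y.2 := rfl
@[simp] theorem fst_mul (x y : SplitExtension T) : (x * y).1 = x.1 * y.1 := rfl
@[simp] theorem snd_mul (x y : SplitExtension T) :
    (x * y).2 = x.1 • y.2 + MulOpposite.op y.1 • x.2 + T.θ x.2 y.2 := rfl

instance : Ring (SplitExtension T) where
  __ := (inferInstance : AddCommGroup (SplitExtension T))
  zero_mul x := by ext <;> simp
  mul_zero x := by ext <;> simp
  left_distrib x y z := by
    ext
    · simp [mul_add]
    · simp only [snd_mul, snd_add, fst_add, smul_add, MulOpposite.op_add, add_smul, map_add]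
      abel
  right_distrib x y z := by
    ext
    · simp [add_mul]
    · simp only [snd_mul, snd_add, fst_add, smul_add, add_smul, map_add, AddMonoidHom.add_apply]
      abel
  mul_assoc x y z := by
    ext
    · simp [mul_assoc]
    · simp only [snd_mul, fst_mul, smul_add, map_add, AddMonoidHom.add_apply, MulOpposite.op_mul,
        mul_smul, T.balanced, T.map_smul_left, T.map_smul_right, T.assoc,
        smul_comm x.1 (MulOpposite.op z.1) y.2]
      abel
  one_mul x := by ext <;> simp
  mul_one x := by ext <;> simp

variable {k : Type w} [Field k] [Algebra k Γ] [Module k M]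

instance : Module k (SplitExtension T) := inferInstanceAs (Module k (Γ × M))

@[simp] theorem fst_smul (c : k) (x : SplitExtension T) : (c • x).1 = c • x.1 := rfl
@[simp] theorem snd_smul (c : k) (x : SplitExtension T) : (c • x).2 = c • x.2 := rfl

variable [IsScalarTower k Γ M] [IsScalarTower k Γᵐᵒᵖ M]

/-- The `k`-algebra structure with `c ↦ (c • 1, 0)`. Both scalar tower conditions together say
that `k` acts centrally on `M`. -/
instance : Algebra k (SplitExtension T) :=
  Algebra.ofModule
    (fun c x y => by
      ext
      · simp
      · simp only [snd_mul, snd_smul, fst_smul, smul_add, smul_assoc]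
        rw [← algebraMap_smul Γ c x.2, T.map_smul_left, algebraMap_smul Γ, algebraMap_smul Γ,
          smul_comm c (MulOpposite.op y.1) x.2])
    (fun c x y => by
      ext
      · simp
      · simp only [snd_mul, snd_smul, fst_smul, smul_add, MulOpposite.op_smul, smul_assoc]
        rw [← algebraMap_smul Γᵐᵒᵖ c y.2, MulOpposite.algebraMap_apply, T.map_smul_right,
          ← MulOpposite.algebraMap_apply, algebraMap_smul, algebraMap_smul,
          smul_comm c x.1 y.2])

end SplitExtension

/-- `Λ` is isomorphic, as a `k`-algebra, to a split extension of `Γ` by a nilpotent multiplicative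
bimodule, finite dimensional over `k` and with `k` acting centrally. -/
def IsNilpotentSplitExtension (k : Type w) [Field k] (Γ : Type u) [Ring Γ] [Algebra k Γ]
    (Λ : Type v) [Ring Λ] [Algebra k Λ] : Prop :=
  ∃ (M : Type v) (_ : AddCommGroup M) (_ : Module k M) (_ : Module Γ M) (_ : Module Γᵐᵒᵖ M)
    (_ : SMulCommClass Γ Γᵐᵒᵖ M) (_ : IsScalarTower k Γ M) (_ : IsScalarTower k Γᵐᵒᵖ M)
    (_ : Module.Finite k M) (T : MultiplicativeBimodule Γ M),
    T.IsNilpotent ∧ Nonempty (Λ ≃ₐ[k] SplitExtension T)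

/-! ### Split quotients by superfluous ideals -/

/-- `Γ` is isomorphic to a split algebra quotient of `Λ` over a superfluous ideal: to `Λ / K` for
an ideal `K` contained in the Jacobson radical of `Λ` such that the natural epimorphism
`Λ → Λ / K` has a section that is a homomorphism of `k`-algebras. -/
def IsSuperfluousSplitQuotient (k : Type w) [Field k] (Γ : Type u) [Ring Γ] [Algebra k Γ]
    (Λ : Type v) [Ring Λ] [Algebra k Λ] : Prop :=
  ∃ (K : Ideal Λ) (_ : K.IsTwoSided), K ≤ Ring.jacobson Λ ∧
    (∃ s : (Λ ⧸ K) →ₐ[k] Λ, ∀ x : Λ ⧸ K, Ideal.Quotient.mk K (s x) = x) ∧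
    Nonempty (Γ ≃ₐ[k] (Λ ⧸ K))

/-! ### Basic algebras with one-dimensional simple modules -/

/-- An idempotent is primitive if it is nonzero and not the sum of two nonzero orthogonal
idempotents. -/
def IsPrimitiveIdempotent {R : Type u} [Ring R] (e : R) : Prop :=
  IsIdempotentElem e ∧ e ≠ 0 ∧
    ∀ f g : R, IsIdempotentElem f → IsIdempotentElem g → f * g = 0 → g * f = 0 →
      e = f + g → f = 0 ∨ g = 0

/-- A ring is basic if it has a complete set of primitive orthogonal idempotents `e i` such that
the left modules `R e i` are pairwise non-isomorphic. -/
def IsBasicRing (R : Type u) [Ring R] : Prop :=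
  ∃ (n : ℕ) (e : Fin n → R), CompleteOrthogonalIdempotents e ∧
    (∀ i, IsPrimitiveIdempotent (e i)) ∧
    ∀ i j, i ≠ j → IsEmpty (Submodule.span R {e i} ≃ₗ[R] Submodule.span R {e j})

/-- A finite dimensional basic algebra all of whose simple (left) modules are one-dimensional. -/
structure IsBasicWithOneDimSimples (k : Type w) [Field k] (R : Type u) [Ring R] [Algebra k R] :
    Prop where
  finite : Module.Finite k R
  basic : IsBasicRing R
  finrank_simple : ∀ (S : Type u) [AddCommGroup S] [Module k S] [Module R S]
    [IsScalarTower k R S] [IsSimpleModule R S], Module.finrank k S = 1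

/-! Everything turns on one statement, `exists_boundQuiver_of_section`. It concerns a
finite-dimensional algebra `Λ` with a surjection `π` onto `k ^ V` whose kernel `J` is nilpotent, and
a map `g : Λ → Γ` with section `s` such that `π ∘ s ∘ g = π`. Put `σ = s ∘ g`, an idempotent algebra
endomorphism. Idempotents lifted along `π` and then pushed through `σ` are fixed by `σ`, so the
Peirce decomposition of `Λ` is refined by the splitting into the image and the kernel of `σ`. Both
`J` and `J ^ 2` are stable under the projections, hence elements of `J` inducing a basis of `J / J ^
2` can be chosen homogeneous. They are the arrows of a quiver whose path algebra maps onto `Λ` with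
admissible kernel `I`. Let `A` consist of the arrows killed by `σ`; the others are fixed by it. Then
`σ` lifts to the endomorphism of the path algebra that kills `A`, which is `avoiding A`. So `I` is
stable under `avoiding A`, which is pre-removability, and the kernel of `g` is the ideal generated
by `A`.

Applied to the projection of a split extension by a nilpotent bimodule, this gives the "if" half of
(1), the pre-removal in (1), and (iii) ⇒ (i). It needs `Γ` to be a power of `k` modulo a nilpotent
ideal. For bound quiver algebras the arrows generate such an ideal; in (2) it follows from the
independence of characters and the one-dimensionality of simple modules.

For (i) ⇒ (ii), pre-removability lets the endomorphism killing `A` descend to the bound quiver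
algebra, where it induces a section of the quotient by `A`. For (ii) ⇒ (iii), the kernel is a
bimodule through the section, and its multiplication is nilpotent because it lies in the radical.
For the "only if" half of (1), the map from the split extension to `k ^ ι` through `Γ` factors over
the semisimple quotient of the given presentation. Equal numbers of vertices make the induced map
bijective, so `M` lies in the nilpotent kernel of that presentation. -/

namespace PathAlgebra

/-! ### Realizations of a quiver and the maps they induce on the path algebra -/

/-- A quiver `V` realized in a ring `Λ`: orthogonal idempotents for the vertices and elements
between them for the arrows. -/
structure Realization (V : Type u) [Quiver.{v} V] [Fintype V] (Λ : Type x) [Ring Λ] where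
  /-- the idempotents of the vertices -/
  e : V → Λ
  /-- the elements of the arrows -/
  arr : ∀ {a b : V}, (a ⟶ b) → Λ
  idem : CompleteOrthogonalIdempotents e
  e_mul : ∀ {a b : V} (α : a ⟶ b), e a * arr α = arr α
  mul_e : ∀ {a b : V} (α : a ⟶ b), arr α * e b = arr α

namespace Realization

variable {V : Type u} [Quiver.{v} V] [Fintype V] {Λ : Type x} [Ring Λ] (R : Realization V Λ)

/-- The value of a path: the product of the values of its arrows. -/
def eval {a : V} : ∀ {b : V}, Quiver.Path a b → Λ
  | _, Quiver.Path.nil => R.e a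
  | _, Quiver.Path.cons p α => eval p * R.arr α

@[simp] theorem eval_nil (a : V) : R.eval (Quiver.Path.nil : Quiver.Path a a) = R.e a := rfl

@[simp] theorem eval_cons {a b c : V} (p : Quiver.Path a b) (α : b ⟶ c) :
    R.eval (p.cons α) = R.eval p * R.arr α := rfl

theorem eval_toPath {a b : V} (α : a ⟶ b) : R.eval α.toPath = R.arr α := R.e_mul α

theorem e_mul_eval {a b : V} (p : Quiver.Path a b) : R.e a * R.eval p = R.eval p := by
  induction p with
  | nil => exact R.idem.idem a
  | cons p α ih => rw [eval_cons, ← mul_assoc, ih]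

theorem eval_mul_e {a b : V} (p : Quiver.Path a b) : R.eval p * R.e b = R.eval p := by
  cases p with
  | nil => exact R.idem.idem a
  | cons p α => rw [eval_cons, mul_assoc, R.mul_e]

theorem eval_comp {a b c : V} (p : Quiver.Path a b) (q : Quiver.Path b c) :
    R.eval (p.comp q) = R.eval p * R.eval q := by
  induction q with
  | nil => rw [Quiver.Path.comp_nil, eval_nil, eval_mul_e]
  | cons q α ih => rw [Quiver.Path.comp_cons, eval_cons, eval_cons, ih, mul_assoc]

theorem eval_mul_eval_of_ne {a b c d : V} (p : Quiver.Path a b) (q : Quiver.Path c d)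
    (h : b ≠ c) : R.eval p * R.eval q = 0 := by
  rw [← R.eval_mul_e p, ← R.e_mul_eval q, mul_assoc, ← mul_assoc (R.e b), R.idem.ortho h,
    zero_mul, mul_zero]

variable (k : Type w) [Field k] [Algebra k Λ]

/-- The algebra homomorphism from the path algebra given by a realization of the quiver. -/
noncomputable def lift : PathAlgebra k V →ₐ[k] Λ :=
  AlgHom.ofLinearMap ((pathBasis k V).constr k fun p => R.eval p.2.2)
    (by
      rw [one_def, map_sum]
      simp_rw [← pathBasis_apply, Module.Basis.constr_basis]
      exact R.idem.complete)
    (by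
      intro y z
      induction y using induction_on with
      | zero => simp
      | add y₁ y₂ h₁ h₂ => rw [add_mul, map_add, map_add, h₁, h₂, add_mul]
      | smul c p =>
        induction z using induction_on with
        | zero => simp
        | add z₁ z₂ h₁ h₂ => rw [mul_add, map_add, map_add, h₁, h₂, mul_add]
        | smul d q =>
          rw [smul_mul_smul_comm, map_smul, map_smul, map_smul, smul_mul_smul_comm]
          congr 1
          rename_i a b a' b'
          by_cases h : b = a'
          · subst h
            rw [ofPath_mul_ofPath]
            simp_rw [← pathBasis_apply, Module.Basis.constr_basis]
            exact R.eval_comp p q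
          · rw [ofPath_mul_ofPath_of_ne _ _ h, map_zero]
            simp_rw [← pathBasis_apply, Module.Basis.constr_basis]
            exact (R.eval_mul_eval_of_ne p q h).symm)

@[simp] theorem lift_ofPath {a b : V} (p : Quiver.Path a b) :
    R.lift k (ofPath k p) = R.eval p := by
  rw [← pathBasis_apply]
  exact Module.Basis.constr_basis (pathBasis k V) k (fun p => R.eval p.2.2) _

end Realization

/-! ### Coefficients and the filtration by path length -/

section

variable {k : Type w} [Field k] {V : Type u} [Quiver.{v} V]

theorem coeff_add {a b : V} (p : Quiver.Path a b) (y z : PathAlgebra k V) :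
    (y + z).coeff p = y.coeff p + z.coeff p := by
  simp [coeff]

theorem coeff_smul {a b : V} (p : Quiver.Path a b) (c : k) (z : PathAlgebra k V) :
    (c • z).coeff p = c * z.coeff p := by
  simp [coeff]

theorem coeff_ofPath_self {a b : V} (p : Quiver.Path a b) : (ofPath k p).coeff p = 1 := by
  simp [coeff, ← pathBasis_apply]

theorem coeff_ofPath_of_ne {a b c d : V} (p : Quiver.Path a b) (q : Quiver.Path c d)
    (h : (⟨a, b, p⟩ : QuiverPath V) ≠ ⟨c, d, q⟩) : (ofPath k p).coeff q = 0 := by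
  simp [coeff, ← pathBasis_apply, h]

theorem algHom_ext [Fintype V] {Λ : Type x} [Ring Λ] [Algebra k Λ]
    {f g : PathAlgebra k V →ₐ[k] Λ}
    (h : ∀ {a b : V} (p : Quiver.Path a b), f (ofPath k p) = g (ofPath k p)) : f = g := by
  ext z
  induction z using induction_on with
  | zero => simp
  | add y z hy hz => rw [map_add, map_add, hy, hz]
  | smul c p => rw [map_smul, map_smul, h p]

theorem algHom_ext_of_arrows [Fintype V] {Λ : Type x} [Ring Λ] [Algebra k Λ]
    {f g : PathAlgebra k V →ₐ[k] Λ}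
    (h₀ : ∀ a : V, f (ofPath k (Quiver.Path.nil : Quiver.Path a a)) =
      g (ofPath k (Quiver.Path.nil : Quiver.Path a a)))
    (h₁ : ∀ {a b : V} (α : a ⟶ b), f (ofPath k α.toPath) = g (ofPath k α.toPath)) : f = g := by
  refine algHom_ext fun {a b} p => ?_
  induction p with
  | nil => exact h₀ a
  | cons p α ih =>
    have hc : p.cons α = p.comp α.toPath := rfl
    rw [hc, ← ofPath_mul_ofPath, map_mul, map_mul, ih, h₁]

/-- The span of the paths of length at least `n`. -/
noncomputable def lengthGE (k : Type w) [Field k] (V : Type u) [Quiver.{v} V] (n : ℕ) :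
    Submodule k (PathAlgebra k V) :=
  Submodule.span k {z | ∃ (a b : V) (p : Quiver.Path a b), n ≤ p.length ∧ z = ofPath k p}

theorem ofPath_mem_lengthGE {a b : V} (p : Quiver.Path a b) {n : ℕ} (h : n ≤ p.length) :
    ofPath k p ∈ lengthGE k V n :=
  Submodule.subset_span ⟨a, b, p, h, rfl⟩

theorem lengthGE_mul_le [Fintype V] (m n : ℕ) :
    lengthGE k V m * lengthGE k V n ≤ lengthGE k V (m + n) := by
  rw [lengthGE, lengthGE, Submodule.span_mul_span, Submodule.span_le]
  rintro _ ⟨_, ⟨a, b, p, hp, rfl⟩, _, ⟨c, d, q, hq, rfl⟩, rfl⟩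
  by_cases h : b = c
  · subst h
    simp only [ofPath_mul_ofPath]
    exact ofPath_mem_lengthGE _ (by rw [Quiver.Path.length_comp]; omega)
  · simp only [ofPath_mul_ofPath_of_ne _ _ h]
    exact Submodule.zero_mem _

theorem lengthGE_zero : lengthGE k V 0 = ⊤ := by
  rw [eq_top_iff]
  intro z _
  induction z using induction_on with
  | zero => exact Submodule.zero_mem _
  | add y z hy hz => exact Submodule.add_mem _ (hy trivial) (hz trivial)
  | smul c p => exact Submodule.smul_mem _ _ (ofPath_mem_lengthGE p (Nat.zero_le _))

theorem lengthGE_one_pow_le [Fintype V] (n : ℕ) : lengthGE k V 1 ^ n ≤ lengthGE k V n := by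
  induction n with
  | zero => rw [lengthGE_zero]; exact le_top
  | succ n ih =>
    rw [pow_succ]
    exact (mul_le_mul' ih le_rfl).trans (lengthGE_mul_le n 1)

/-- A longer path begins with a path of length exactly `N`. -/
theorem lengthGE_le_of_forall_length_eq [Fintype V] (I : Ideal (PathAlgebra k V)) [I.IsTwoSided]
    (N : ℕ) (h : ∀ (a b : V) (p : Quiver.Path a b), p.length = N → ofPath k p ∈ I) :
    lengthGE k V N ≤ I.restrictScalars k := by
  rw [lengthGE, Submodule.span_le]
  rintro _ ⟨a, b, p, hp, rfl⟩
  obtain ⟨c, p₁, p₂, rfl, hl⟩ := p.exists_eq_comp_of_le_length hp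
  rw [← ofPath_mul_ofPath]
  exact I.mul_mem_right _ (h _ _ _ hl)

end

/-! ### Killing a set of arrows -/

section Through

variable {k : Type w} [Field k] {V : Type u} [Quiver.{v} V] (A : Set (Quiver.Total V))

theorem not_passesThrough_nil (a : V) :
    ¬ PassesThrough A (Quiver.Path.nil : Quiver.Path a a) := by
  rintro ⟨α, -, p₁, p₂, h⟩
  have := congrArg Quiver.Path.length h
  simp only [Quiver.Path.length_nil, Quiver.Path.length_comp, Quiver.Path.length_cons] at this
  omega

theorem passesThrough_cons {a b c : V} (p : Quiver.Path a b) (α : b ⟶ c) :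
    PassesThrough A (p.cons α) ↔ PassesThrough A p ∨ (⟨b, c, α⟩ : Quiver.Total V) ∈ A := by
  constructor
  · rintro ⟨⟨b', c', β⟩, hβ, p₁, p₂, h⟩
    cases p₂ with
    | nil =>
      cases h
      exact Or.inr hβ
    | cons p₂ γ =>
      rw [Quiver.Path.comp_cons] at h
      cases h
      exact Or.inl ⟨⟨b', c', β⟩, hβ, p₁, p₂, rfl⟩
  · rintro (⟨β, hβ, p₁, p₂, rfl⟩ | h)
    · exact ⟨β, hβ, p₁, p₂.cons α, by rw [Quiver.Path.comp_cons]⟩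
    · exact ⟨⟨b, c, α⟩, h, p, Quiver.Path.nil, rfl⟩

theorem avoiding_add (y z : PathAlgebra k V) :
    avoiding A (y + z) = avoiding A y + avoiding A z := by
  simp [avoiding, Finsupp.filter_add]

theorem avoiding_smul (c : k) (z : PathAlgebra k V) :
    avoiding A (c • z) = c • avoiding A z := by
  simp [avoiding, Finsupp.filter_smul]

theorem avoiding_ofPath_of_not {a b : V} {p : Quiver.Path a b} (h : ¬ PassesThrough A p) :
    avoiding A (ofPath k p) = ofPath k p := by
  classical
  rw [avoiding, ← pathBasis_apply, Module.Basis.repr_self, Finsupp.filter_single_of_pos,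
    Module.Basis.repr_symm_single_one]
  exact h

theorem avoiding_ofPath_of_passesThrough {a b : V} {p : Quiver.Path a b}
    (h : PassesThrough A p) : avoiding A (ofPath k p) = 0 := by
  classical
  rw [avoiding, ← pathBasis_apply, Module.Basis.repr_self, Finsupp.filter_single_of_neg,
    map_zero]
  exact not_not.mpr h

variable [Fintype V]

theorem completeOrthogonalIdempotents_nil :
    CompleteOrthogonalIdempotents
      fun a : V => ofPath k (Quiver.Path.nil : Quiver.Path a a) where
  idem _ := ofPath_mul_ofPath _ _
  ortho _ _ h := ofPath_mul_ofPath_of_ne _ _ h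
  complete := one_def.symm

open Classical in
variable (k) in
/-- The realization of the quiver in its path algebra that kills the arrows in `A`. -/
noncomputable def killRealization : Realization V (PathAlgebra k V) where
  e a := ofPath k (Quiver.Path.nil : Quiver.Path a a)
  arr {a b} α := if (⟨a, b, α⟩ : Quiver.Total V) ∈ A then 0 else ofPath k α.toPath
  idem := completeOrthogonalIdempotents_nil
  e_mul α := by
    split_ifs
    · exact mul_zero _
    · rw [ofPath_mul_ofPath, Quiver.Path.nil_comp]
  mul_e α := by
    split_ifs
    · exact zero_mul _
    · rw [ofPath_mul_ofPath, Quiver.Path.comp_nil]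

theorem killRealization_eval {a b : V} (p : Quiver.Path a b) :
    (killRealization k A).eval p = avoiding A (ofPath k p) := by
  induction p with
  | nil => exact (avoiding_ofPath_of_not A (not_passesThrough_nil A a)).symm
  | @cons b c p α ih =>
    have hc : p.cons α = p.comp α.toPath := rfl
    rw [Realization.eval_cons, ih]
    by_cases hp : PassesThrough A p
    · rw [avoiding_ofPath_of_passesThrough A hp, zero_mul,
        avoiding_ofPath_of_passesThrough A ((passesThrough_cons A p α).mpr (Or.inl hp))]
    · rw [avoiding_ofPath_of_not A hp]
      by_cases hα : (⟨b, c, α⟩ : Quiver.Total V) ∈ A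
      · rw [avoiding_ofPath_of_passesThrough A ((passesThrough_cons A p α).mpr (Or.inr hα))]
        simp [killRealization, hα]
      · rw [avoiding_ofPath_of_not A (by rw [passesThrough_cons]; tauto), hc,
          ← ofPath_mul_ofPath]
        simp [killRealization, hα]

/-- A path avoids `A` exactly when each of its arrows does, so discarding the paths through `A` is
multiplicative. This is what allows pre-removability to be treated as stability of an ideal under an
algebra endomorphism. -/
theorem killRealization_lift (z : PathAlgebra k V) :
    (killRealization k A).lift k z = avoiding A z := by
  induction z using induction_on with
  | zero => rw [map_zero, avoiding, map_zero, Finsupp.filter_zero, map_zero]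
  | add y z hy hz => rw [map_add, hy, hz, avoiding_add]
  | smul c p => rw [map_smul, avoiding_smul, Realization.lift_ofPath, killRealization_eval]

end Through

end PathAlgebra

/-! ### Powers of the field modulo a nilpotent ideal -/

section SplitBasic

/-- A `k`-algebra is split basic with index set `ι` if it is `k ^ ι` modulo a nilpotent ideal. -/
def IsSplitBasic (k : Type w) [Field k] (ι : Type v) (Γ : Type u) [Ring Γ] [Algebra k Γ] : Prop :=
  ∃ π : Γ →ₐ[k] (ι → k), Function.Surjective π ∧
    ∃ N : ℕ, (LinearMap.ker π.toLinearMap) ^ N = ⊥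

theorem isNilpotent_of_mem_of_pow_eq_bot {k : Type w} [Field k] {Γ : Type u} [Ring Γ] [Algebra k Γ]
    {J : Submodule k Γ} {N : ℕ} (h : J ^ N = ⊥) {x : Γ} (hx : x ∈ J) : IsNilpotent x :=
  ⟨N, by simpa [h] using Submodule.pow_mem_pow J hx N⟩

theorem IsSplitBasic.of_equiv_index {k : Type w} [Field k] {ι : Type v} {κ : Type x} {Γ : Type u}
    [Ring Γ] [Algebra k Γ] (e : ι ≃ κ) (h : IsSplitBasic k ι Γ) : IsSplitBasic k κ Γ := by
  obtain ⟨π, hπ, N, hN⟩ := h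
  refine ⟨(AlgEquiv.piCongrLeft k (fun _ : κ => k) e).toAlgHom.comp π,
    (AlgEquiv.piCongrLeft k (fun _ : κ => k) e).surjective.comp hπ, N, ?_⟩
  rw [← hN]
  congr 1
  ext x
  exact map_eq_zero_iff _ (AlgEquiv.piCongrLeft k (fun _ : κ => k) e).injective

/-- For `x` in the ideal, `y * x` is again nilpotent, so `y * x + 1` is a unit for every `y`. -/
theorem le_jacobson_of_forall_isNilpotent {R : Type u} [Ring R] (I : Ideal R)
    (h : ∀ x ∈ I, IsNilpotent x) : I ≤ Ring.jacobson R := by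
  intro x hx
  rw [← Ideal.jacobson_bot, Ideal.mem_jacobson_iff]
  intro y
  obtain ⟨u, hu⟩ := (h (y * x) (I.mul_mem_left y hx)).isUnit_add_one
  refine ⟨↑u⁻¹, ?_⟩
  have : (↑u⁻¹ : R) * (y * x + 1) = 1 := by rw [← hu, Units.inv_mul]
  rw [Ideal.mem_bot, sub_eq_zero, ← this, mul_add, mul_one, mul_assoc]

end SplitBasic

/-! ### The projection of the path algebra onto the vertices -/

namespace PathAlgebra

variable {k : Type w} [Field k] {V : Type u} [Quiver.{v} V] [Fintype V]

open Classical in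
variable (k V) in
/-- The realization of the quiver in `k ^ V` that kills all arrows. -/
noncomputable def vertexRealization : Realization V (V → k) where
  e a := Pi.single a 1
  arr _ := 0
  idem := CompleteOrthogonalIdempotents.single (fun _ : V => k)
  e_mul _ := mul_zero _
  mul_e _ := zero_mul _

theorem vertexRealization_eval_of_pos {a b : V} (p : Quiver.Path a b) (h : 1 ≤ p.length) :
    (vertexRealization k V).eval p = 0 := by
  cases p with
  | nil => simp at h
  | cons p α => exact mul_zero _

theorem lift_vertexRealization (z : PathAlgebra k V) (a : V) :
    (vertexRealization k V).lift k z a = z.coeff (Quiver.Path.nil : Quiver.Path a a) := by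
  classical
  induction z using PathAlgebra.induction_on with
  | zero => simp [coeff]
  | add y z hy hz => rw [map_add, Pi.add_apply, hy, hz, coeff_add]
  | smul c p =>
    rw [map_smul, Pi.smul_apply, coeff_smul, smul_eq_mul, Realization.lift_ofPath]
    congr 1
    rename_i b d
    cases p with
    | nil =>
      by_cases h : a = b
      · subst h
        rw [coeff_ofPath_self]
        simp [vertexRealization]
      · rw [coeff_ofPath_of_ne _ _ (fun h' => h (congrArg Sigma.fst h').symm)]
        simp [vertexRealization, h]
    | cons p α =>
      rw [vertexRealization_eval_of_pos _ (by simp), coeff_ofPath_of_ne]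
      · rfl
      · intro h
        have := congrArg (fun q : QuiverPath V => q.2.2.length) h
        simp at this

theorem mem_lengthGE_one_of_lift_eq_zero (z : PathAlgebra k V)
    (h : (vertexRealization k V).lift k z = 0) : z ∈ lengthGE k V 1 := by
  -- Vanishing of the vertex part does not pass to summands, so the induction runs over all `z`,
  -- with the vertex part subtracted.
  suffices H : ∀ z : PathAlgebra k V, z - ∑ a, (vertexRealization k V).lift k z a •
      ofPath k (Quiver.Path.nil : Quiver.Path a a) ∈ lengthGE k V 1 by
    simpa [h] using H z
  clear h z
  intro z
  induction z using PathAlgebra.induction_on with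
  | zero => simp
  | add y z hy hz =>
    have := Submodule.add_mem _ hy hz
    rw [map_add]
    simp only [Pi.add_apply, add_smul, Finset.sum_add_distrib]
    rwa [add_sub_add_comm]
  | smul c p =>
    rw [map_smul, Realization.lift_ofPath]
    simp only [Pi.smul_apply, smul_assoc, ← Finset.smul_sum]
    rw [← smul_sub]
    refine Submodule.smul_mem _ _ ?_
    cases p with
    | nil =>
      classical
      rename_i a
      have : (vertexRealization k V).eval (Quiver.Path.nil : Quiver.Path a a)
          = Pi.single a 1 := by
        simp only [Realization.eval_nil, vertexRealization]
      rw [this, Finset.sum_eq_single a]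
      · simp
      · intro b _ hb
        simp [hb]
      · simp
    | cons p α =>
      rw [vertexRealization_eval_of_pos _ (by simp)]
      simpa using ofPath_mem_lengthGE (p.cons α) (n := 1) (by simp)

end PathAlgebra

/-! ### The semisimple quotient and finite dimension of a bound quiver algebra -/

namespace BoundQuiver

variable {k : Type w} [Field k] (B : BoundQuiver.{u, v, w} k)

open PathAlgebra

/-- The projection of a bound quiver algebra onto `k ^ V`. -/
noncomputable def proj : B.algebra →ₐ[k] (B.V → k) :=
  Ideal.Quotient.liftₐ B.I ((vertexRealization k B.V).lift k) (by
    intro z hz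
    ext a
    rw [lift_vertexRealization]
    by_contra h
    simpa using B.admissible.two_le_length z hz _ _ _ h)

theorem proj_mk (z : PathAlgebra k B.V) :
    B.proj (Ideal.Quotient.mk B.I z) = (vertexRealization k B.V).lift k z := rfl

theorem proj_surjective : Function.Surjective B.proj := by
  classical
  intro f
  refine ⟨Ideal.Quotient.mk B.I
    (∑ a, f a • ofPath k (Quiver.Path.nil : Quiver.Path a a)), ?_⟩
  rw [proj_mk]
  ext b
  simp [vertexRealization, Pi.single_apply]

theorem exists_ker_proj_pow_eq_bot :
    ∃ N : ℕ, (LinearMap.ker B.proj.toLinearMap) ^ N = ⊥ := by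
  obtain ⟨N, -, hN⟩ := B.admissible.exists_length
  refine ⟨N, ?_⟩
  have hle : LinearMap.ker B.proj.toLinearMap ≤
      (lengthGE k B.V 1).map (Ideal.Quotient.mkₐ k B.I).toLinearMap := by
    intro x hx
    obtain ⟨z, rfl⟩ := Ideal.Quotient.mk_surjective x
    exact ⟨z, mem_lengthGE_one_of_lift_eq_zero z hx, rfl⟩
  rw [eq_bot_iff]
  refine (pow_le_pow_left' hle N).trans ?_
  rw [← Submodule.map_pow]
  rintro _ ⟨z, hz, rfl⟩
  have := lengthGE_le_of_forall_length_eq B.I N hN (lengthGE_one_pow_le N hz)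
  exact Ideal.Quotient.eq_zero_iff_mem.mpr this

theorem isSplitBasic : IsSplitBasic k B.V B.algebra :=
  ⟨B.proj, B.proj_surjective, B.exists_ker_proj_pow_eq_bot⟩

instance : Module.Finite k B.algebra := by
  obtain ⟨N, -, hN⟩ := B.admissible.exists_length
  set S : Set (PathAlgebra k B.V) :=
    Set.range (fun a : B.V => ofPath k (Quiver.Path.nil : Quiver.Path a a)) ∪
      Set.range (fun α : Σ a b : B.V, (a ⟶ b) => ofPath k α.2.2.toPath) with hS
  have hfin : S.Finite := (Set.finite_range _).union (Set.finite_range _)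
  have hone : (1 : PathAlgebra k B.V) ∈ Submodule.span k S := by
    rw [one_def]
    exact Submodule.sum_mem _ fun a _ => Submodule.subset_span (Or.inl ⟨a, rfl⟩)
  -- The exponent is `n + 1` because a trivial path already uses one factor from `S`; shorter paths
  -- are padded with `1`, which lies in the span of `S`.
  have hpath : ∀ (n : ℕ) (a b : B.V) (p : Quiver.Path a b), p.length ≤ n →
      ofPath k p ∈ Submodule.span k S ^ (n + 1) := by
    intro n
    induction n with
    | zero =>
      intro a b p hp
      cases p with
      | nil =>
        rw [zero_add, pow_one]
        exact Submodule.subset_span (Or.inl ⟨a, rfl⟩)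
      | cons p α => simp at hp
    | succ n ih =>
      intro a b p hp
      rw [pow_succ]
      cases p with
      | nil =>
        rw [← mul_one (ofPath k _)]
        exact Submodule.mul_mem_mul (ih _ _ _ (by simp)) hone
      | @cons c _ p α =>
        have : p.cons α = p.comp α.toPath := rfl
        rw [this, ← ofPath_mul_ofPath]
        refine Submodule.mul_mem_mul (ih _ _ _ (by simpa using hp))
          (Submodule.subset_span (Or.inr ⟨⟨_, _, α⟩, rfl⟩))
  have hfg : ((Submodule.span k S ^ (N + 1)).map (Ideal.Quotient.mkₐ k B.I).toLinearMap).FG :=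
    ((Submodule.fg_span hfin).pow _).map _
  suffices h : (⊤ : Submodule k B.algebra) ≤
      (Submodule.span k S ^ (N + 1)).map (Ideal.Quotient.mkₐ k B.I).toLinearMap from
    ⟨(top_le_iff.mp h) ▸ hfg⟩
  intro x _
  obtain ⟨z, rfl⟩ := Ideal.Quotient.mk_surjective x
  induction z using PathAlgebra.induction_on with
  | zero => simp
  | add y z hy hz =>
    rw [map_add]
    exact Submodule.add_mem _ (hy trivial) (hz trivial)
  | smul c p =>
    have : Ideal.Quotient.mk B.I (c • ofPath k p) = c • Ideal.Quotient.mk B.I (ofPath k p) := rfl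
    rw [this]
    refine Submodule.smul_mem _ _ ?_
    by_cases h : p.length ≤ N
    · exact ⟨_, hpath N _ _ p h, rfl⟩
    · have := lengthGE_le_of_forall_length_eq B.I N hN
        (ofPath_mem_lengthGE p (by omega : N ≤ p.length))
      rw [Ideal.Quotient.eq_zero_iff_mem.mpr this]
      exact Submodule.zero_mem _

end BoundQuiver

/-! ### Homogeneous bases modulo a subspace -/

section LinearAlgebra

variable {k : Type w} [Field k] {E : Type u} [AddCommGroup E] [Module k E] [Module.Finite k E]

theorem exists_basis_modulo (U W : Submodule k E) :
    ∃ (d : ℕ) (x : Fin d → E), (∀ j, x j ∈ U) ∧ U ≤ Submodule.span k (Set.range x) ⊔ W ∧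
      LinearIndependent k fun j => W.mkQ (x j) := by
  let b := Module.finBasis k (U.map W.mkQ)
  have hb : ∀ j, ∃ y ∈ U, W.mkQ y = b j := fun j => (b j).2
  choose x hxU hx using hb
  refine ⟨_, x, hxU, ?_, ?_⟩
  · have hspan : U.map W.mkQ ≤ (Submodule.span k (Set.range x)).map W.mkQ := by
      rw [Submodule.map_span, ← Set.range_comp]
      have : (W.mkQ ∘ x) = (U.map W.mkQ).subtype ∘ b := funext hx
      rw [this, Set.range_comp, ← Submodule.map_span, b.span_eq, Submodule.map_top,
        Submodule.range_subtype]
    intro y hy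
    obtain ⟨z, hz, hzy⟩ := hspan (Submodule.mem_map_of_mem hy)
    refine Submodule.mem_sup.mpr ⟨z, hz, y - z, ?_, add_sub_cancel _ _⟩
    rw [← Submodule.ker_mkQ W, LinearMap.mem_ker, map_sub, hzy, sub_self]
  · have : (fun j => W.mkQ (x j)) = (U.map W.mkQ).subtype ∘ b := funext hx
    rw [this]
    exact b.linearIndependent.map' _ (Submodule.ker_subtype _)

/-- A basis modulo `W` is chosen separately in each component `p i U`. Since `W` is graded too, the
union of these families stays independent modulo `W`. -/
theorem exists_graded_basis_modulo {ι : Type v} [Fintype ι] (p : ι → E →ₗ[k] E)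
    (hself : ∀ i y, p i (p i y) = p i y) (hne : ∀ i j, i ≠ j → ∀ y, p i (p j y) = 0)
    (hsum : ∀ y, ∑ i, p i y = y) (U W : Submodule k E)
    (hU : ∀ i, ∀ y ∈ U, p i y ∈ U) (hW : ∀ i, ∀ y ∈ W, p i y ∈ W) :
    ∃ (d : ι → ℕ) (x : ∀ i, Fin (d i) → E), (∀ i j, x i j ∈ U) ∧ (∀ i j, p i (x i j) = x i j) ∧
      U ≤ Submodule.span k (Set.range fun s : Σ i, Fin (d i) => x s.1 s.2) ⊔ W ∧
      LinearIndependent k fun s : Σ i, Fin (d i) => W.mkQ (x s.1 s.2) := by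
  choose d x hx hspan hli using fun i => exists_basis_modulo (U.map (p i)) W
  have hpx : ∀ i j, p i (x i j) = x i j := by
    intro i j
    obtain ⟨y, -, hy⟩ := hx i j
    rw [← hy, hself]
  refine ⟨d, x, ?_, hpx, ?_, ?_⟩
  · intro i j
    obtain ⟨y, hyU, hy⟩ := hx i j
    exact hy ▸ hU i y hyU
  · intro y hy
    rw [← hsum y]
    refine Submodule.sum_mem _ fun i _ => ?_
    refine (sup_le_sup_right (Submodule.span_mono ?_) W)
      (hspan i (Submodule.mem_map_of_mem hy))
    rintro _ ⟨j, rfl⟩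
    exact ⟨⟨i, j⟩, rfl⟩
  · rw [Fintype.linearIndependent_iff]
    rintro c hc ⟨i, j⟩
    have hmem : ∑ s : Σ i, Fin (d i), c s • x s.1 s.2 ∈ W := by
      rw [← Submodule.ker_mkQ W, LinearMap.mem_ker, map_sum]
      simpa using hc
    -- Applying `p i` keeps the relation inside `W` and retains only the terms of index `i`.
    have hi := hW i _ hmem
    rw [map_sum, Fintype.sum_sigma, Finset.sum_eq_single i] at hi
    · refine Fintype.linearIndependent_iff.mp (hli i) (fun j => c ⟨i, j⟩) ?_ j
      simp only [map_smul, hpx] at hi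
      rw [← Submodule.ker_mkQ W, LinearMap.mem_ker, map_sum] at hi
      simpa using hi
    · intro i' _ hi'
      refine Finset.sum_eq_zero fun j _ => ?_
      rw [map_smul, ← hpx i' j, hne i i' hi'.symm, smul_zero]
    · simp

end LinearAlgebra

/-! ### Presentations from a basis of the radical modulo its square -/

namespace PathAlgebra

section

variable {k : Type w} [Field k] {V : Type u} [Quiver.{v} V]

theorem sub_arrows_mem_lengthGE_two [Fintype (Σ a b : V, (a ⟶ b))] (z : PathAlgebra k V)
    (h : z ∈ lengthGE k V 1) :
    z - ∑ α : Σ a b : V, (a ⟶ b), z.coeff α.2.2.toPath • ofPath k α.2.2.toPath ∈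
      lengthGE k V 2 := by
  induction h using Submodule.span_induction with
  | zero => simp [coeff]
  | add y z _ _ hy hz =>
    simp only [coeff_add, add_smul, Finset.sum_add_distrib]
    rw [add_sub_add_comm]
    exact Submodule.add_mem _ hy hz
  | smul c z _ hz =>
    simp only [coeff_smul, mul_smul, ← Finset.smul_sum]
    rw [← smul_sub]
    exact Submodule.smul_mem _ _ hz
  | mem z hz =>
    obtain ⟨a, b, p, hp, rfl⟩ := hz
    by_cases h2 : 2 ≤ p.length
    · rw [Finset.sum_eq_zero, sub_zero]
      · exact ofPath_mem_lengthGE p h2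
      · rintro α -
        rw [coeff_ofPath_of_ne, zero_smul]
        intro h
        have := congrArg (fun q : QuiverPath V => q.2.2.length) h
        simp only [Quiver.Path.length_toPath] at this
        omega
    · cases p with
      | nil => simp at hp
      | @cons c _ p β =>
        cases p with
        | cons p γ => simp at h2
        | nil =>
          have hβ : (Quiver.Path.nil : Quiver.Path a a).cons β = β.toPath := rfl
          rw [hβ, Finset.sum_eq_single ⟨a, b, β⟩]
          · rw [coeff_ofPath_self, one_smul, sub_self]
            exact Submodule.zero_mem _
          · rintro ⟨a', b', α⟩ - hα
            rw [coeff_ofPath_of_ne, zero_smul]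
            intro h
            apply hα
            cases h
            rfl
          · simp

end

section Presentation

variable {k : Type w} [Field k] {V : Type u} [Quiver.{v} V] [Fintype V] {Λ : Type x} [Ring Λ]
  [Algebra k Λ] (π : Λ →ₐ[k] (V → k))

/-- Multiplying out the hypothesis gives `J ^ (n + 1) ≤ X ^ (n + 1) ⊔ J ^ (n + 2)`, and `S` absorbs
the powers of `X`. For nilpotent `J` this shows that generators modulo `J ^ 2` generate all of `J`.
-/
theorem le_sup_pow_of_le_sup_sq {X J : Submodule k Λ} {S : Subalgebra k Λ}
    (hXJ : X ≤ J) (hXS : X ≤ Subalgebra.toSubmodule S) (h : J ≤ X ⊔ J ^ 2) (n : ℕ) :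
    J ≤ Subalgebra.toSubmodule S ⊔ J ^ (n + 1) := by
  have hpow : ∀ n : ℕ, J ^ (n + 1) ≤ X ^ (n + 1) ⊔ J ^ (n + 2) := by
    intro n
    induction n with
    | zero => simpa using h
    | succ n ih =>
      calc J ^ (n + 1 + 1) = J ^ (n + 1) * J := pow_succ _ _
        _ ≤ (X ^ (n + 1) ⊔ J ^ (n + 2)) * J := mul_le_mul' ih le_rfl
        _ = X ^ (n + 1) * J ⊔ J ^ (n + 2) * J := Submodule.sup_mul _ _ _
        _ ≤ X ^ (n + 1) * (X ⊔ J ^ 2) ⊔ J ^ (n + 3) :=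
          sup_le_sup (mul_le_mul' le_rfl h) (pow_succ J (n + 2)).ge
        _ = X ^ (n + 1) * X ⊔ X ^ (n + 1) * J ^ 2 ⊔ J ^ (n + 3) := by rw [Submodule.mul_sup]
        _ ≤ X ^ (n + 2) ⊔ J ^ (n + 3) ⊔ J ^ (n + 3) := by
          refine sup_le_sup_right (sup_le_sup (pow_succ X (n + 1)).ge ?_) _
          refine (mul_le_mul' (pow_le_pow_left' hXJ _) le_rfl).trans ?_
          rw [← pow_add]
        _ = X ^ (n + 1 + 1) ⊔ J ^ (n + 1 + 2) := by rw [sup_assoc, sup_idem]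
  have hXpow : ∀ n : ℕ, X ^ n ≤ Subalgebra.toSubmodule S := by
    intro n
    induction n with
    | zero =>
      rw [pow_zero, Submodule.one_le]
      exact S.one_mem
    | succ n ih =>
      rw [pow_succ, Submodule.mul_le]
      exact fun y hy z hz => S.mul_mem (ih hy) (hXS hz)
  induction n with
  | zero => simp
  | succ n ih =>
    refine ih.trans (sup_le le_sup_left ((hpow n).trans ?_))
    exact sup_le_sup_right (hXpow _) _

namespace Realization

variable (R : Realization V Λ)

section

open Classical in
theorem comp_lift_eq_vertexRealization_lift (he : ∀ a, π (R.e a) = Pi.single a 1)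
    (harr : ∀ {a b : V} (α : a ⟶ b), π (R.arr α) = 0) :
    π.comp (R.lift k) = (vertexRealization k V).lift k := by
  refine algHom_ext_of_arrows (fun a => ?_) fun α => ?_
  · simpa [vertexRealization] using he a
  · rw [AlgHom.comp_apply, lift_ofPath, lift_ofPath, eval_toPath, eval_toPath, harr]
    rfl

open Classical in
-- Subtracting a combination of the `R.e a` moves any element into `J`, and `J` lies in the range
-- because the arrows span it modulo `J ^ 2`.
theorem lift_surjective (he : ∀ a, π (R.e a) = Pi.single a 1)
    (harr : ∀ {a b : V} (α : a ⟶ b), π (R.arr α) = 0) {N : ℕ}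
    (hN : (LinearMap.ker π.toLinearMap) ^ N = ⊥)
    (hgen : LinearMap.ker π.toLinearMap ≤
      Submodule.span k (Set.range fun α : Σ a b : V, (a ⟶ b) => R.arr α.2.2) ⊔
        (LinearMap.ker π.toLinearMap) ^ 2) :
    Function.Surjective (R.lift k) := by
  set J := LinearMap.ker π.toLinearMap
  have hJ : J ≤ Subalgebra.toSubmodule (R.lift k).range := by
    have := le_sup_pow_of_le_sup_sq (S := (R.lift k).range) ?_ ?_ hgen N
    · rwa [pow_succ, hN, Submodule.bot_mul, sup_bot_eq] at this
    · rw [Submodule.span_le]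
      rintro _ ⟨α, rfl⟩
      exact harr _
    · rw [Submodule.span_le]
      rintro _ ⟨α, rfl⟩
      exact ⟨ofPath k α.2.2.toPath, by simp [eval_toPath]⟩
  intro y
  have hy : y - ∑ a, π y a • R.e a ∈ J := by
    change π (y - ∑ a, π y a • R.e a) = 0
    rw [map_sub, map_sum, sub_eq_zero]
    ext b
    simp [he, Pi.single_apply]
  have hsum : ∑ a, π y a • R.e a ∈ (R.lift k).range :=
    Subalgebra.sum_mem _ fun a _ => Subalgebra.smul_mem _
      (show R.e a ∈ (R.lift k).range from
        ⟨ofPath k (Quiver.Path.nil : Quiver.Path a a), by simp⟩) _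
  have := (R.lift k).range.add_mem (hJ hy) hsum
  rwa [sub_add_cancel] at this

theorem eval_mem_pow (harr : ∀ {a b : V} (α : a ⟶ b), π (R.arr α) = 0) (n : ℕ) :
    ∀ {a b : V} (p : Quiver.Path a b), p.length = n + 1 →
      R.eval p ∈ (LinearMap.ker π.toLinearMap) ^ (n + 1) := by
  induction n with
  | zero =>
    intro a b p hp
    cases p with
    | nil => simp at hp
    | cons p α =>
      rw [zero_add, pow_one]
      change π (R.eval p * R.arr α) = 0
      rw [map_mul, harr, mul_zero]
  | succ n ih =>
    intro a b p hp
    cases p with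
    | nil => simp at hp
    | cons p α =>
      rw [pow_succ]
      exact Submodule.mul_mem_mul (ih p (by simpa using hp)) (harr α)

theorem lift_mem_sq (harr : ∀ {a b : V} (α : a ⟶ b), π (R.arr α) = 0) {z : PathAlgebra k V}
    (hz : z ∈ lengthGE k V 2) : R.lift k z ∈ (LinearMap.ker π.toLinearMap) ^ 2 := by
  suffices lengthGE k V 2 ≤ ((LinearMap.ker π.toLinearMap) ^ 2).comap (R.lift k).toLinearMap from
    this hz
  rw [lengthGE, Submodule.span_le]
  rintro _ ⟨a, b, p, hp, rfl⟩
  change R.lift k (ofPath k p) ∈ (LinearMap.ker π.toLinearMap) ^ 2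
  rw [lift_ofPath]
  cases p with
  | nil => simp at hp
  | cons p α =>
    cases p with
    | nil => simp at hp
    | cons p β =>
      rw [pow_two]
      refine Submodule.mul_mem_mul ?_ (harr α)
      change π (R.eval p * R.arr β) = 0
      rw [map_mul, harr, mul_zero]

open Classical in
-- For `z` in the kernel, applying `π` shows that the trivial paths have coefficient zero. Modulo `J
-- ^ 2` only the arrows of `z` then contribute to its value, and their independence there forces
-- their coefficients to vanish.
theorem isAdmissible_ker_lift [∀ a b : V, Finite (a ⟶ b)] (he : ∀ a, π (R.e a) = Pi.single a 1)
    (harr : ∀ {a b : V} (α : a ⟶ b), π (R.arr α) = 0) {N : ℕ}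
    (hN : (LinearMap.ker π.toLinearMap) ^ N = ⊥)
    (hli : LinearIndependent k fun α : Σ a b : V, (a ⟶ b) =>
      ((LinearMap.ker π.toLinearMap) ^ 2).mkQ (R.arr α.2.2)) :
    IsAdmissible (RingHom.ker (R.lift k)) where
  two_le_length := by
    intro z hz
    have hz' : R.lift k z = 0 := hz
    have hv : (vertexRealization k V).lift k z = 0 := by
      rw [← R.comp_lift_eq_vertexRealization_lift π he harr, AlgHom.comp_apply, hz', map_zero]
    have := Fintype.ofFinite (Σ a b : V, (a ⟶ b))
    have hsub := sub_arrows_mem_lengthGE_two z (mem_lengthGE_one_of_lift_eq_zero z hv)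
    have hmem := R.lift_mem_sq π harr hsub
    rw [map_sub, hz', zero_sub, Submodule.neg_mem_iff, map_sum] at hmem
    simp only [map_smul, lift_ofPath, eval_toPath] at hmem
    have hcoeff := Fintype.linearIndependent_iff.mp hli
      (fun α => z.coeff α.2.2.toPath) (by
        rw [← Submodule.ker_mkQ ((LinearMap.ker π.toLinearMap) ^ 2), LinearMap.mem_ker,
          map_sum] at hmem
        simpa using hmem)
    intro a b p hp
    by_contra hlt
    apply hp
    cases p with
    | nil => rw [← lift_vertexRealization, hv, Pi.zero_apply]
    | cons p α =>
      cases p with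
      | cons p β => simp at hlt
      | nil => exact hcoeff ⟨_, _, α⟩
  exists_length := by
    -- `N` may be as small as `0`, while the length has to exceed `1`.
    refine ⟨N + 2, by omega, fun a b p hp => ?_⟩
    have := R.eval_mem_pow π harr (N + 1) p hp
    rw [RingHom.mem_ker, lift_ofPath]
    rw [add_assoc, pow_add, hN, Submodule.bot_mul] at this
    exact this

end

end Realization

end Presentation

end PathAlgebra

open PathAlgebra

/-! ### The ideal generated by a set of arrows -/

namespace BoundQuiver

variable {k : Type w} [Field k] (B : BoundQuiver.{u, v, w} k) (A : Set (Quiver.Total B.V))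

theorem arrowIdeal_le (K : Ideal B.algebra) [K.IsTwoSided]
    (h : ∀ α ∈ A, Ideal.Quotient.mk B.I (ofPath k α.hom.toPath) ∈ K) : B.arrowIdeal A ≤ K := by
  intro x hx
  have : TwoSidedIdeal.span {x : B.algebra | ∃ α ∈ A,
      x = Ideal.Quotient.mk B.I (ofPath k α.hom.toPath)} ≤ K.toTwoSided := by
    rw [TwoSidedIdeal.span_le]
    rintro _ ⟨α, hα, rfl⟩
    exact Ideal.mem_toTwoSided.mpr (h α hα)
  exact Ideal.mem_toTwoSided.mp (this (TwoSidedIdeal.mem_asIdeal.mp hx))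

theorem mk_arrow_mem_arrowIdeal {α : Quiver.Total B.V} (hα : α ∈ A) :
    Ideal.Quotient.mk B.I (ofPath k α.hom.toPath) ∈ B.arrowIdeal A :=
  TwoSidedIdeal.mem_asIdeal.mpr (TwoSidedIdeal.subset_span ⟨α, hα, rfl⟩)

theorem mk_sub_avoiding_mem_arrowIdeal (z : PathAlgebra k B.V) :
    Ideal.Quotient.mk B.I (z - avoiding A z) ∈ B.arrowIdeal A := by
  induction z using PathAlgebra.induction_on with
  | zero =>
    rw [avoiding, map_zero, Finsupp.filter_zero, map_zero, sub_zero, map_zero]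
    exact Ideal.zero_mem _
  | add y z hy hz =>
    rw [avoiding_add, add_sub_add_comm, map_add]
    exact Ideal.add_mem _ hy hz
  | smul c p =>
    rw [avoiding_smul, ← smul_sub, Algebra.smul_def, map_mul]
    refine Ideal.mul_mem_left _ _ ?_
    by_cases h : PassesThrough A p
    · rw [avoiding_ofPath_of_passesThrough A h, sub_zero]
      obtain ⟨α, hα, p₁, p₂, rfl⟩ := h
      have hc : p₁.cons α.hom = p₁.comp α.hom.toPath := rfl
      rw [hc, ← ofPath_mul_ofPath, ← ofPath_mul_ofPath, map_mul, map_mul]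
      exact Ideal.mul_mem_right _ _ (Ideal.mul_mem_left _ _ (B.mk_arrow_mem_arrowIdeal A hα))
    · rw [avoiding_ofPath_of_not A h, sub_self, map_zero]
      exact Ideal.zero_mem _

theorem mk_through_mem_arrowIdeal (z : PathAlgebra k B.V) :
    Ideal.Quotient.mk B.I (through A z) ∈ B.arrowIdeal A := by
  rw [← add_sub_cancel_right (through A z) (avoiding A z), through_add_avoiding]
  exact B.mk_sub_avoiding_mem_arrowIdeal A z

end BoundQuiver

/-! ### The Peirce decomposition refined by an idempotent endomorphism -/

section

variable {k : Type w} [Field k] {V : Type} {Λ : Type u} [Ring Λ] [Algebra k Λ]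

open Classical in
theorem exists_idempotents_of_ker_nilpotent [Fintype V] (π : Λ →ₐ[k] (V → k))
    (hπ : Function.Surjective π) {N : ℕ} (hN : (LinearMap.ker π.toLinearMap) ^ N = ⊥) :
    ∃ e : V → Λ, CompleteOrthogonalIdempotents e ∧ ∀ a, π (e a) = Pi.single a 1 := by
  obtain ⟨e, he, h⟩ := CompleteOrthogonalIdempotents.lift_of_isNilpotent_ker (π : Λ →+* (V → k))
    (fun y hy => isNilpotent_of_mem_of_pow_eq_bot hN hy)
    (CompleteOrthogonalIdempotents.single (fun _ : V => k)) (fun i => hπ _)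
  exact ⟨e, he, fun a => congrFun h a⟩

/-- The two complementary projections belonging to an idempotent endomorphism `σ`. -/
noncomputable def splitPart (σ : Λ →ₐ[k] Λ) (t : Bool) : Λ →ₗ[k] Λ :=
  if t then LinearMap.id - σ.toLinearMap else σ.toLinearMap

@[simp] theorem splitPart_true (σ : Λ →ₐ[k] Λ) (y : Λ) : splitPart σ true y = y - σ y := rfl

@[simp] theorem splitPart_false (σ : Λ →ₐ[k] Λ) (y : Λ) : splitPart σ false y = σ y := rfl

theorem splitPart_mul_left (σ : Λ →ₐ[k] Λ) {u : Λ} (hu : σ u = u) (t : Bool) (y : Λ) :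
    splitPart σ t (u * y) = u * splitPart σ t y := by
  cases t <;> simp [hu, mul_sub]

theorem splitPart_mul_right (σ : Λ →ₐ[k] Λ) {u : Λ} (hu : σ u = u) (t : Bool) (y : Λ) :
    splitPart σ t (y * u) = splitPart σ t y * u := by
  cases t <;> simp [hu, sub_mul]

theorem splitPart_self {σ : Λ →ₐ[k] Λ} (hσ : ∀ y, σ (σ y) = σ y) (t : Bool) (y : Λ) :
    splitPart σ t (splitPart σ t y) = splitPart σ t y := by
  cases t <;> simp [hσ]

theorem splitPart_of_ne {σ : Λ →ₐ[k] Λ} (hσ : ∀ y, σ (σ y) = σ y) {t t' : Bool} (h : t ≠ t')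
    (y : Λ) : splitPart σ t (splitPart σ t' y) = 0 := by
  cases t <;> cases t' <;> simp [hσ] at h ⊢

/-- The Peirce component of an element between two idempotents, in one of the two summands
belonging to an idempotent endomorphism `σ`. -/
noncomputable def peirceProj (e : V → Λ) (σ : Λ →ₐ[k] Λ) (i : V × V × Bool) : Λ →ₗ[k] Λ :=
  LinearMap.mulLeft k (e i.1) ∘ₗ LinearMap.mulRight k (e i.2.1) ∘ₗ splitPart σ i.2.2

theorem peirceProj_apply (e : V → Λ) (σ : Λ →ₐ[k] Λ) (i : V × V × Bool) (y : Λ) :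
    peirceProj e σ i y = e i.1 * (splitPart σ i.2.2 y * e i.2.1) := rfl

theorem peirceProj_mul_e [Fintype V] {e : V → Λ} (σ : Λ →ₐ[k] Λ) 
    (he : CompleteOrthogonalIdempotents e)
    (i : V × V × Bool) (y : Λ) : peirceProj e σ i y * e i.2.1 = peirceProj e σ i y := by
  simp only [peirceProj_apply, mul_assoc, (he.idem i.2.1).eq]

theorem e_mul_peirceProj [Fintype V] {e : V → Λ} (σ : Λ →ₐ[k] Λ) (he : CompleteOrthogonalIdempotents e)
    (i : V × V × Bool) (y : Λ) : e i.1 * peirceProj e σ i y = peirceProj e σ i y := by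
  simp only [peirceProj_apply, ← mul_assoc, (he.idem i.1).eq]

theorem splitPart_peirceProj {e : V → Λ} {σ : Λ →ₐ[k] Λ} (hσe : ∀ a, σ (e a) = e a) (t : Bool)
    (i : V × V × Bool) (y : Λ) : splitPart σ t (peirceProj e σ i y) =
      e i.1 * (splitPart σ t (splitPart σ i.2.2 y) * e i.2.1) := by
  rw [peirceProj_apply, splitPart_mul_left σ (hσe _), splitPart_mul_right σ (hσe _)]

theorem peirceProj_self [Fintype V] {e : V → Λ} {σ : Λ →ₐ[k] Λ} (he : CompleteOrthogonalIdempotents e)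
    (hσe : ∀ a, σ (e a) = e a) (hσ : ∀ y, σ (σ y) = σ y) (i : V × V × Bool) (y : Λ) :
    peirceProj e σ i (peirceProj e σ i y) = peirceProj e σ i y := by
  rw [peirceProj_apply e σ i (peirceProj e σ i y), splitPart_peirceProj hσe,
    splitPart_self hσ, ← peirceProj_apply, peirceProj_mul_e σ he, e_mul_peirceProj σ he]

theorem peirceProj_of_ne [Fintype V] {e : V → Λ} {σ : Λ →ₐ[k] Λ} (he : CompleteOrthogonalIdempotents e)
    (hσe : ∀ a, σ (e a) = e a) (hσ : ∀ y, σ (σ y) = σ y) (i j : V × V × Bool) (h : i ≠ j)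
    (y : Λ) : peirceProj e σ i (peirceProj e σ j y) = 0 := by
  rw [peirceProj_apply, splitPart_peirceProj hσe]
  obtain ⟨a, b, t⟩ := i
  obtain ⟨c, d, t'⟩ := j
  by_cases ht : t = t'
  · by_cases ha : a = c
    · by_cases hb : b = d
      · exact absurd (by rw [ha, hb, ht]) h
      · simp only [mul_assoc, he.ortho (Ne.symm hb), mul_zero]
    · simp only [← mul_assoc, he.ortho ha, zero_mul]
  · simp only [splitPart_of_ne hσ ht, zero_mul, mul_zero]

theorem sum_peirceProj [Fintype V] {e : V → Λ} (σ : Λ →ₐ[k] Λ) (he : CompleteOrthogonalIdempotents e)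
    (y : Λ) : ∑ i, peirceProj e σ i y = y := by
  simp only [peirceProj_apply, Fintype.sum_prod_type, Fintype.sum_bool,
    splitPart_true, splitPart_false, sub_add_cancel, ← Finset.mul_sum, ← Finset.sum_mul,
    he.complete, mul_one, one_mul]

theorem splitPart_mem_ker {π : Λ →ₐ[k] (V → k)} {σ : Λ →ₐ[k] Λ} (hπσ : ∀ y, π (σ y) = π y)
    (t : Bool) {y : Λ} (hy : y ∈ LinearMap.ker π.toLinearMap) :
    splitPart σ t y ∈ LinearMap.ker π.toLinearMap := by
  have hy' : π y = 0 := hy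
  change π (splitPart σ t y) = 0
  cases t <;> simp [hπσ, hy']

theorem peirceProj_mem_ker {π : Λ →ₐ[k] (V → k)} {σ : Λ →ₐ[k] Λ} (hπσ : ∀ y, π (σ y) = π y)
    (e : V → Λ) (i : V × V × Bool) {y : Λ} (hy : y ∈ LinearMap.ker π.toLinearMap) :
    peirceProj e σ i y ∈ LinearMap.ker π.toLinearMap := by
  have h : π (splitPart σ i.2.2 y) = 0 := splitPart_mem_ker hπσ _ hy
  change π (e i.1 * (splitPart σ i.2.2 y * e i.2.1)) = 0
  rw [map_mul, map_mul, h, zero_mul, mul_zero]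

/-- On a product of two elements of `J`, `σ` acts factorwise and preserves `J` because `π ∘ σ = π`.
So `σ` and `id - σ` both preserve `J * J`, as does multiplication on either side. -/
theorem peirceProj_mem_ker_sq {π : Λ →ₐ[k] (V → k)} {σ : Λ →ₐ[k] Λ} (hπσ : ∀ y, π (σ y) = π y)
    (e : V → Λ) (i : V × V × Bool) {y : Λ} (hy : y ∈ (LinearMap.ker π.toLinearMap) ^ 2) :
    peirceProj e σ i y ∈ (LinearMap.ker π.toLinearMap) ^ 2 := by
  set J := LinearMap.ker π.toLinearMap with hJ
  have hleft : ∀ u, ∀ y ∈ J, u * y ∈ J := by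
    intro u y hy
    have hy' : π y = 0 := hy
    change π (u * y) = 0
    rw [map_mul, hy', mul_zero]
  have hright : ∀ u, ∀ y ∈ J, y * u ∈ J := by
    intro u y hy
    have hy' : π y = 0 := hy
    change π (y * u) = 0
    rw [map_mul, hy', zero_mul]
  rw [pow_two] at hy ⊢
  induction hy using Submodule.mul_induction_on' with
  | add y _ z _ hy hz => rw [map_add]; exact Submodule.add_mem _ hy hz
  | mem_mul_mem y hy z hz =>
    have hσJ : σ y * σ z ∈ J * J :=
      Submodule.mul_mem_mul (splitPart_mem_ker hπσ false hy) (splitPart_mem_ker hπσ false hz)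
    have hmem : ∀ u v, ∀ y ∈ J * J, u * (y * v) ∈ J * J := by
      intro u v y hy
      induction hy using Submodule.mul_induction_on' with
      | add y _ z _ hy hz => rw [add_mul, mul_add]; exact Submodule.add_mem _ hy hz
      | mem_mul_mem y hy z hz =>
        rw [mul_assoc y, ← mul_assoc u]
        exact Submodule.mul_mem_mul (hleft _ _ hy) (hright _ _ hz)
    rw [peirceProj_apply]
    apply hmem
    cases i.2.2 with
    | false => simpa using hσJ
    | true =>
      rw [splitPart_true, map_mul]
      exact Submodule.sub_mem _ (Submodule.mul_mem_mul hy hz) hσJ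

end

/-! ### Presentations adapted to a split epimorphism -/

section

variable {k : Type w} [Field k] {V : Type} [Fintype V] {Λ : Type u} [Ring Λ] [Algebra k Λ]
  {Γ : Type v} [Ring Γ] [Algebra k Γ]

/-- The bound quiver algebra given by a presentation of `Λ` in which every arrow is either fixed
or killed by the idempotent endomorphism `s ∘ g`. -/
theorem exists_boundQuiver_of_realization [Quiver.{0} V] [∀ a b : V, Finite (a ⟶ b)]
    (R : Realization V Λ) (hsurj : Function.Surjective (R.lift k))
    (hadm : IsAdmissible (RingHom.ker (R.lift k))) (g : Λ →ₐ[k] Γ) (s : Γ →ₐ[k] Λ)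
    (hgs : ∀ y, g (s y) = y) (A : Set (Quiver.Total V)) (he : ∀ a, s (g (R.e a)) = R.e a)
    (hmem : ∀ {a b : V} (α : a ⟶ b), (⟨a, b, α⟩ : Quiver.Total V) ∈ A → g (R.arr α) = 0)
    (hnot : ∀ {a b : V} (α : a ⟶ b), (⟨a, b, α⟩ : Quiver.Total V) ∉ A →
      s (g (R.arr α)) = R.arr α) :
    ∃ C : BoundQuiver.{0, 0, w} k, Fintype.card C.V = Fintype.card V ∧
      Nonempty (Λ ≃ₐ[k] C.algebra) ∧
      ∃ A : Set (Quiver.Total C.V), C.IsPreRemovable A ∧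
        Nonempty (Γ ≃ₐ[k] (C.algebra ⧸ C.arrowIdeal A)) := by
  let C : BoundQuiver.{0, 0, w} k :=
    { V := V, I := RingHom.ker (R.lift k), admissible := hadm }
  let Φ : C.algebra ≃ₐ[k] Λ := Ideal.quotientKerAlgEquivOfSurjective hsurj
  have hΦ : ∀ z, Φ (Ideal.Quotient.mk C.I z) = R.lift k z := fun z => rfl
  -- Both sides agree on vertices and arrows. Pre-removability and the computation of the kernel of
  -- `g` are consequences of this identity.
  have hcomp : ((s.comp g).comp (R.lift k)) = (R.lift k).comp ((killRealization k A).lift k) := by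
    refine algHom_ext_of_arrows (fun a => ?_) fun {a b} α => ?_
    · simp [killRealization, he]
    · simp only [AlgHom.comp_apply, Realization.lift_ofPath, Realization.eval_toPath]
      by_cases hα : (⟨a, b, α⟩ : Quiver.Total V) ∈ A
      · simp [killRealization, hα, hmem α hα]
      · simp [killRealization, hα, hnot α hα, Realization.eval_toPath]
  have hav : ∀ z, R.lift k (avoiding A z) = s (g (R.lift k z)) := by
    intro z
    rw [← killRealization_lift]
    exact (DFunLike.congr_fun hcomp z).symm
  refine ⟨C, rfl, ⟨Φ.symm⟩, A, ?_, ?_⟩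
  · intro z hz
    have hz' : R.lift k z = 0 := hz
    have h₁ : avoiding A z ∈ C.I := by
      change R.lift k (avoiding A z) = 0
      rw [hav, hz', map_zero, map_zero]
    refine ⟨?_, h₁⟩
    rw [← add_sub_cancel_right (through A z) (avoiding A z), through_add_avoiding]
    exact C.I.sub_mem hz h₁
  · let h : C.algebra →ₐ[k] Γ := g.comp Φ.toAlgHom
    have hh : Function.Surjective h :=
      (Function.RightInverse.surjective hgs).comp Φ.surjective
    have : (C.arrowIdeal A).IsTwoSided :=
      inferInstanceAs ((TwoSidedIdeal.asIdeal _).IsTwoSided)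
    have hker : C.arrowIdeal A = RingHom.ker h := by
      apply le_antisymm
      · exact C.arrowIdeal_le A _ fun α hα => by
          change g (Φ (Ideal.Quotient.mk C.I _)) = 0
          rw [hΦ, Realization.lift_ofPath, Realization.eval_toPath]
          exact hmem _ hα
      · intro y hy
        obtain ⟨z, rfl⟩ := Ideal.Quotient.mk_surjective y
        have hz : g (R.lift k z) = 0 := hy
        -- Once `g` kills the value of `z`, the part avoiding `A` is a relation, so `z` is congruent
        -- to its part through `A`.
        have : Ideal.Quotient.mk C.I (avoiding A z) = 0 := by
          rw [Ideal.Quotient.eq_zero_iff_mem]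
          change R.lift k (avoiding A z) = 0
          rw [hav, hz, map_zero]
        rw [← through_add_avoiding A z, map_add, this, add_zero]
        exact C.mk_through_mem_arrowIdeal A z
    exact ⟨((Ideal.quotientEquivAlgOfEq k hker).trans
      (Ideal.quotientKerAlgEquivOfSurjective hh)).symm⟩

/-- The heart of the proof: the arrows are chosen homogeneous for both the vertex idempotents and `σ
= s ∘ g`, so that each is either fixed or killed by `σ`. -/
theorem exists_boundQuiver_of_section [Module.Finite k Λ] (π : Λ →ₐ[k] (V → k))
    (hπ : Function.Surjective π) {N : ℕ} (hN : (LinearMap.ker π.toLinearMap) ^ N = ⊥)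
    (g : Λ →ₐ[k] Γ) (s : Γ →ₐ[k] Λ) (hgs : ∀ y, g (s y) = y) (hπσ : ∀ y, π (s (g y)) = π y) :
    ∃ C : BoundQuiver.{0, 0, w} k, Fintype.card C.V = Fintype.card V ∧
      Nonempty (Λ ≃ₐ[k] C.algebra) ∧
      ∃ A : Set (Quiver.Total C.V), C.IsPreRemovable A ∧
        Nonempty (Γ ≃ₐ[k] (C.algebra ⧸ C.arrowIdeal A)) := by
  classical
  let σ : Λ →ₐ[k] Λ := s.comp g
  have hσ : ∀ y, σ (σ y) = σ y := fun y => congrArg s (hgs _)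
  obtain ⟨f, hf, hπf⟩ := exists_idempotents_of_ker_nilpotent π hπ hN
  -- Applying `σ` makes the idempotents `σ`-fixed; since `π ∘ σ = π`, their images under `π` do not
  -- change.
  let e : V → Λ := fun a => σ (f a)
  have he : CompleteOrthogonalIdempotents e := hf.map (σ : Λ →+* Λ)
  have hσe : ∀ a, σ (e a) = e a := fun a => hσ _
  have hπe : ∀ a, π (e a) = Pi.single a 1 := fun a =>
    (hπσ (f a)).trans (by convert hπf a)
  obtain ⟨d, y, hyJ, hy, hspan, hli⟩ := exists_graded_basis_modulo (peirceProj e σ)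
    (peirceProj_self he hσe hσ) (peirceProj_of_ne he hσe hσ) (sum_peirceProj σ he)
    (LinearMap.ker π.toLinearMap) ((LinearMap.ker π.toLinearMap) ^ 2)
    (fun i _ h => peirceProj_mem_ker hπσ e i h) (fun i _ h => peirceProj_mem_ker_sq hπσ e i h)
  let _ : Quiver.{0} V := ⟨fun a b => Σ t : Bool, Fin (d (a, b, t))⟩
  have : ∀ a b : V, Finite (a ⟶ b) := fun a b =>
    inferInstanceAs (Finite (Σ t : Bool, Fin (d (a, b, t))))
  let R : Realization V Λ :=
    { e := e
      arr := fun {a b} α => y (a, b, α.1) α.2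
      idem := he
      e_mul := fun {a b} α => by rw [← hy (a, b, α.1) α.2, e_mul_peirceProj σ he (a, b, α.1)]
      mul_e := fun {a b} α => by rw [← hy (a, b, α.1) α.2, peirceProj_mul_e σ he (a, b, α.1)] }
  have harr : ∀ {a b : V} (α : a ⟶ b), π (R.arr α) = 0 := fun α => hyJ _ _
  have hsp : ∀ (i : V × V × Bool) (j : Fin (d i)), splitPart σ i.2.2 (y i j) = y i j := by
    intro i j
    rw [← hy i j, splitPart_peirceProj hσe, splitPart_self hσ, peirceProj_apply]
  -- The tag `true` marks the components in the image of `id - σ`, which is the kernel of `σ`; these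
  -- arrows form `A`.
  refine exists_boundQuiver_of_realization R
    (R.lift_surjective π (fun a => by convert hπe a) harr hN ?_)
    (R.isAdmissible_ker_lift π (fun a => by convert hπe a) harr hN ?_)
    g s hgs {α | α.hom.1 = true} hσe ?_ ?_
  · refine hspan.trans (sup_le_sup_right (Submodule.span_mono ?_) _)
    rintro _ ⟨⟨⟨a, b, t⟩, j⟩, rfl⟩
    exact ⟨⟨a, b, ⟨t, j⟩⟩, rfl⟩
  · refine hli.comp (fun α : Σ a b : V, (a ⟶ b) => ⟨(α.1, α.2.1, α.2.2.1), α.2.2.2⟩) ?_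
    rintro ⟨a, b, ⟨t, j⟩⟩ ⟨a', b', ⟨t', j'⟩⟩ h
    cases h
    rfl
  · rintro a b ⟨t, j⟩ rfl
    have h := hsp (a, b, true) j
    rw [splitPart_true, sub_eq_self] at h
    change g (y (a, b, true) j) = 0
    -- Here `g y = g (s (g y)) = g (σ y)`, and `σ y = 0`.
    rw [← hgs (g (y (a, b, true) j))]
    exact (congrArg g h).trans (map_zero g)
  · rintro a b ⟨t, j⟩ ht
    obtain rfl : t = false := by simpa using ht
    exact hsp (a, b, false) j

end

/-! ### Characters and one-dimensional simple modules -/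

section Characters

variable {k : Type w} [Field k] {Γ : Type u} [Ring Γ] [Algebra k Γ]

/-- Dedekind's independence of characters, transferred from functions to linear forms. -/
theorem linearIndependent_characters :
    LinearIndependent k fun χ : Γ →ₐ[k] k => (χ.toLinearMap : Module.Dual k Γ) := by
  have h : LinearIndependent k fun χ : Γ →ₐ[k] k => ((χ : Γ →* k) : Γ → k) :=
    (linearIndependent_monoidHom Γ k).comp (fun χ : Γ →ₐ[k] k => (χ : Γ →* k))
      fun χ₁ χ₂ h => AlgHom.ext fun y => DFunLike.congr_fun h y
  exact LinearIndependent.of_comp (LinearMap.ltoFun k Γ k k) h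

theorem restrictScalars_pow_le (I : Ideal Γ) (n : ℕ) :
    (I.restrictScalars k : Submodule k Γ) ^ n ≤ (I ^ n).restrictScalars k := by
  induction n with
  | zero => exact fun _ _ => by simp [Submodule.pow_zero, Ideal.one_eq_top]
  | succ n ih =>
    rw [pow_succ, Submodule.mul_le, Submodule.pow_succ]
    exact fun y hy z hz => Ideal.mul_mem_mul (ih hy) hz

variable [Module.Finite k Γ]

theorem finite_characters : Finite (Γ →ₐ[k] k) :=
  (linearIndependent_characters (k := k) (Γ := Γ)).finite

/-- A nonzero functional vanishing on a proper range would be a linear relation among the `f i`,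
with its values on the standard vectors as coefficients. -/
theorem pi_surjective_of_linearIndependent {E : Type u} [AddCommGroup E] [Module k E]
    {ι : Type v} [Finite ι] {f : ι → Module.Dual k E} (hf : LinearIndependent k f) :
    Function.Surjective (LinearMap.pi f) := by
  classical
  have := Fintype.ofFinite ι
  rw [← LinearMap.range_eq_top]
  by_contra hne
  obtain ⟨g, hg, hle⟩ := Submodule.exists_le_ker_of_lt_top _ (lt_top_iff_ne_top.mpr hne)
  apply hg
  have hsum : ∑ i, g (Pi.single i 1) • f i = 0 := by
    ext y
    have hy : g (LinearMap.pi f y) = 0 := hle ⟨y, rfl⟩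
    rw [← Finset.univ_sum_single (LinearMap.pi f y), map_sum] at hy
    rw [LinearMap.sum_apply, LinearMap.zero_apply, ← hy]
    refine Finset.sum_congr rfl fun i _ => ?_
    have : (Pi.single i (LinearMap.pi f y i) : ι → k) = f i y • Pi.single i 1 := by
      rw [← Pi.single_smul, smul_eq_mul, mul_one, LinearMap.pi_apply]
    rw [this, map_smul, LinearMap.smul_apply, smul_eq_mul, smul_eq_mul, mul_comm]
  have := Fintype.linearIndependent_iff.mp hf _ hsum
  refine LinearMap.pi_ext' fun i => LinearMap.ext_ring ?_
  simpa using this i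

/-- For a maximal left ideal `m` the simple module `Γ ⧸ m` is a line, so `Γ` acts on it through a
character. If `y` is killed by that character it kills the class of `1`, hence lies in `m`. -/
theorem mem_jacobson_of_characters_eq_zero
    (h : ∀ (S : Type u) [AddCommGroup S] [Module k S] [Module Γ S] [IsScalarTower k Γ S]
      [IsSimpleModule Γ S], Module.finrank k S = 1) (y : Γ)
    (hy : ∀ χ : Γ →ₐ[k] k, χ y = 0) : y ∈ Ring.jacobson Γ := by
  rw [Ring.jacobson_eq_sInf_isMaximal, Submodule.mem_sInf]
  intro m hm
  have hm' : Ideal.IsMaximal m := hm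
  have : IsSimpleModule Γ (Γ ⧸ m) := isSimpleModule_iff_isCoatom.mpr hm'.out
  have h1 := h (Γ ⧸ m)
  let ρ : Γ →ₐ[k] Module.End k (Γ ⧸ m) := Algebra.lsmul k k (Γ ⧸ m)
  have hb : Function.Bijective (Algebra.ofId k (Module.End k (Γ ⧸ m))) := by
    convert (LinearEquiv.smul_id_of_finrank_eq_one h1).bijective using 1
    ext c : 1
    exact Algebra.algebraMap_eq_smul_one c
  have hρ : ρ y = 0 := by
    have := hy ((AlgEquiv.ofBijective _ hb).symm.toAlgHom.comp ρ)
    exact (map_eq_zero_iff _ (AlgEquiv.ofBijective _ hb).symm.injective).mp this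
  have h0 : y • (Submodule.Quotient.mk 1 : Γ ⧸ m) = 0 := LinearMap.congr_fun hρ _
  rw [← Submodule.Quotient.mk_smul, smul_eq_mul, mul_one] at h0
  exact (Submodule.Quotient.mk_eq_zero m).mp h0

theorem exists_pow_eq_bot_of_le_jacobson {J : Submodule k Γ}
    (hJ : J ≤ (Ring.jacobson Γ).restrictScalars k) : ∃ N : ℕ, J ^ N = ⊥ := by
  have : IsArtinianRing Γ := IsArtinianRing.of_finite k Γ
  obtain ⟨N, hN⟩ := IsArtinianRing.isNilpotent_jacobson_bot (R := Γ)
  refine ⟨N, ?_⟩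
  rw [eq_bot_iff]
  refine (pow_le_pow_left' hJ N).trans ((restrictScalars_pow_le _ N).trans ?_)
  rw [← Ideal.jacobson_bot, hN]
  exact le_rfl

theorem isSplitBasic_of_finrank_simple_eq_one
    (h : ∀ (S : Type u) [AddCommGroup S] [Module k S] [Module Γ S] [IsScalarTower k Γ S]
      [IsSimpleModule Γ S], Module.finrank k S = 1) : ∃ n : ℕ, IsSplitBasic k (Fin n) Γ := by
  have hfin : Finite (Γ →ₐ[k] k) := finite_characters
  obtain ⟨n, ⟨e⟩⟩ := hfin.exists_equiv_fin
  let π : Γ →ₐ[k] ((Γ →ₐ[k] k) → k) := AlgHom.pi fun χ => χ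
  have hlin : π.toLinearMap = LinearMap.pi fun χ : Γ →ₐ[k] k => χ.toLinearMap := rfl
  have hπ : Function.Surjective π.toLinearMap := by
    rw [hlin]
    exact pi_surjective_of_linearIndependent linearIndependent_characters
  exact ⟨n, IsSplitBasic.of_equiv_index e ⟨π, hπ,
    exists_pow_eq_bot_of_le_jacobson fun y hy =>
      mem_jacobson_of_characters_eq_zero h y fun χ => congrFun hy χ⟩⟩

end Characters

/-! ### Nilpotency of the bimodule inside its split extension -/

namespace MultiplicativeBimodule

variable {Γ : Type u} [Ring Γ] {M : Type v} [AddCommGroup M]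
  [Module Γ M] [Module Γᵐᵒᵖ M] [SMulCommClass Γ Γᵐᵒᵖ M] (T : MultiplicativeBimodule Γ M)

theorem iter_congr {r : ℕ} {y z : ℕ → M} (h : ∀ i ≤ r, y i = z i) : T.iter r y = T.iter r z := by
  induction r with
  | zero => exact h 0 le_rfl
  | succ r ih =>
    change T.θ (T.iter r y) (y (r + 1)) = T.θ (T.iter r z) (z (r + 1))
    rw [ih fun i hi => h i (hi.trans (Nat.le_succ r)), h _ le_rfl]

end MultiplicativeBimodule

namespace SplitExtension

variable {k : Type w} [Field k] {Γ : Type u} [Ring Γ] [Algebra k Γ] {M : Type v} [AddCommGroup M]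
  [Module k M] [Module Γ M] [Module Γᵐᵒᵖ M] [SMulCommClass Γ Γᵐᵒᵖ M] [IsScalarTower k Γ M]
  [IsScalarTower k Γᵐᵒᵖ M] (T : MultiplicativeBimodule Γ M)

instance [Module.Finite k Γ] [Module.Finite k M] : Module.Finite k (SplitExtension T) :=
  inferInstanceAs (Module.Finite k (Γ × M))

/-- The inclusion of the bimodule in the split extension. -/
def inr (m : M) : SplitExtension T := ((0 : Γ), m)

@[simp] theorem fst_inr (m : M) : (inr T m).1 = 0 := rfl
@[simp] theorem snd_inr (m : M) : (inr T m).2 = m := rfl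

theorem inr_mul_inr (m n : M) : inr T m * inr T n = inr T (T.θ m n) := by
  ext <;> simp

variable (k) in
/-- The projection of the split extension onto `Γ`. -/
def fstHom : SplitExtension T →ₐ[k] Γ :=
  AlgHom.ofLinearMap (LinearMap.fst k Γ M) rfl fun _ _ => rfl

variable (k) in
/-- The inclusion of `Γ` in the split extension. -/
def inlHom : Γ →ₐ[k] SplitExtension T :=
  AlgHom.ofLinearMap (LinearMap.inl k Γ M) rfl fun y z => by
    apply SplitExtension.ext
    · rfl
    · change (0 : M) = y • (0 : M) + MulOpposite.op z • (0 : M) + T.θ 0 0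
      simp

theorem fstHom_apply (y : SplitExtension T) : fstHom k T y = y.1 := rfl

theorem fstHom_inlHom (y : Γ) : fstHom k T (inlHom k T y) = y := rfl

theorem inr_iter_mem_pow {J : Submodule k (SplitExtension T)} (hJ : ∀ m, inr T m ∈ J) (r : ℕ)
    (y : ℕ → M) : inr T (T.iter r y) ∈ J ^ (r + 1) := by
  induction r with
  | zero => rw [zero_add, pow_one]; exact hJ _
  | succ r ih =>
    rw [pow_succ]
    change inr T (T.θ (T.iter r y) (y (r + 1))) ∈ _
    rw [← inr_mul_inr]
    exact Submodule.mul_mem_mul ih (hJ _)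

theorem isNilpotent_of_pow_eq_bot {J : Submodule k (SplitExtension T)} (hJ : ∀ m, inr T m ∈ J)
    {N : ℕ} (hN : J ^ N = ⊥) : T.IsNilpotent := by
  -- The exponent must be positive, and `N` may be `0`.
  refine ⟨N + 1, Nat.succ_pos N, fun y => ?_⟩
  have := inr_iter_mem_pow T hJ (N + 1) y
  rw [add_assoc, pow_add, hN, Submodule.bot_mul] at this
  exact congrArg (fun z : SplitExtension T => z.2) ((Submodule.mem_bot k).mp this)

theorem ker_fstHom_pow_le (r : ℕ) : (LinearMap.ker (fstHom k T).toLinearMap) ^ (r + 1) ≤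
    Submodule.span k {z | ∃ y : ℕ → M, z = inr T (T.iter r y)} := by
  have hK : ∀ z ∈ LinearMap.ker (fstHom k T).toLinearMap, z = inr T z.2 := fun z hz =>
    SplitExtension.ext hz rfl
  induction r with
  | zero =>
    rw [zero_add, pow_one]
    exact fun z hz => Submodule.subset_span ⟨fun _ => z.2, hK z hz⟩
  | succ r ih =>
    rw [pow_succ]
    refine (mul_le_mul' ih le_rfl).trans (Submodule.mul_le.mpr fun y hy z hz => ?_)
    induction hy using Submodule.span_induction with
    | zero => rw [zero_mul]; exact Submodule.zero_mem _
    | add y₁ y₂ _ _ h₁ h₂ => rw [add_mul]; exact Submodule.add_mem _ h₁ h₂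
    | smul c y _ h => rw [smul_mul_assoc]; exact Submodule.smul_mem _ _ h
    | mem y hy =>
      obtain ⟨y, rfl⟩ := hy
      refine Submodule.subset_span ⟨fun i => if i ≤ r then y i else z.2, ?_⟩
      rw [hK z hz, inr_mul_inr]
      change _ = inr T (T.θ (T.iter r fun i => if i ≤ r then y i else z.2)
        (if r + 1 ≤ r then y (r + 1) else z.2))
      rw [if_neg (by omega), T.iter_congr (z := y) fun i hi => if_pos hi]

theorem exists_ker_comp_fstHom_pow_eq_bot {ι : Type x} (π : Γ →ₐ[k] (ι → k)) {N : ℕ}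
    (hN : (LinearMap.ker π.toLinearMap) ^ N = ⊥) (hT : T.IsNilpotent) :
    ∃ N' : ℕ, (LinearMap.ker (π.comp (fstHom k T)).toLinearMap) ^ N' = ⊥ := by
  obtain ⟨r, -, hr⟩ := hT
  refine ⟨N * (r + 1), ?_⟩
  set J := LinearMap.ker (π.comp (fstHom k T)).toLinearMap
  have hmap : J.map (fstHom k T).toLinearMap ≤ LinearMap.ker π.toLinearMap := by
    rintro _ ⟨y, hy, rfl⟩
    exact hy
  have hle : J ^ N ≤ LinearMap.ker (fstHom k T).toLinearMap := by
    intro y hy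
    have := pow_le_pow_left' hmap N
    rw [← Submodule.map_pow, hN] at this
    exact (Submodule.mem_bot k).mp (this (Submodule.mem_map_of_mem hy))
  rw [pow_mul, eq_bot_iff]
  refine (pow_le_pow_left' hle (r + 1)).trans ((ker_fstHom_pow_le T r).trans ?_)
  rw [Submodule.span_le]
  rintro _ ⟨y, rfl⟩
  rw [hr y]
  exact Submodule.zero_mem _

theorem exists_boundQuiver [Module.Finite k Γ] [Module.Finite k M] {V : Type} [Fintype V]
    (hΓ : IsSplitBasic k V Γ) (hT : T.IsNilpotent) :
    ∃ C : BoundQuiver.{0, 0, w} k, Fintype.card C.V = Fintype.card V ∧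
      Nonempty (SplitExtension T ≃ₐ[k] C.algebra) ∧
      ∃ A : Set (Quiver.Total C.V), C.IsPreRemovable A ∧
        Nonempty (Γ ≃ₐ[k] (C.algebra ⧸ C.arrowIdeal A)) := by
  obtain ⟨π, hπ, N, hN⟩ := hΓ
  obtain ⟨N', hN'⟩ := exists_ker_comp_fstHom_pow_eq_bot T π hN hT
  exact exists_boundQuiver_of_section (π.comp (fstHom k T))
    (hπ.comp (Function.RightInverse.surjective (fstHom_inlHom (k := k) T))) hN' (fstHom k T)
    (inlHom k T) (fstHom_inlHom T) fun y => rfl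

theorem isNilpotent_of_equiv {ι κ : Type*} [Fintype ι] [Fintype κ] {Λ : Type x} [Ring Λ]
    [Algebra k Λ] (hΓ : IsSplitBasic k ι Γ) (hΛ : IsSplitBasic k κ Λ)
    (hcard : Fintype.card κ = Fintype.card ι) (ψ : SplitExtension T ≃ₐ[k] Λ) :
    T.IsNilpotent := by
  obtain ⟨π, hπ, -⟩ := hΓ
  obtain ⟨ρ, hρ, N, hN⟩ := hΛ
  have hinl : Function.Surjective (fstHom k T) :=
    Function.RightInverse.surjective (fstHom_inlHom (k := k) T)
  let τ : Λ →ₐ[k] (ι → k) := (π.comp (fstHom k T)).comp ψ.symm.toAlgHom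
  have hτ : Function.Surjective τ := (hπ.comp hinl).comp ψ.symm.surjective
  have hker : ∀ y, ρ y = 0 → τ y = 0 := fun y hy =>
    ((isNilpotent_of_mem_of_pow_eq_bot hN hy).map τ).eq_zero
  obtain ⟨s, hs⟩ := LinearMap.exists_rightInverse_of_surjective ρ.toLinearMap
    (LinearMap.range_eq_top.mpr hρ)
  have hs' : ∀ c, ρ (s c) = c := fun c => LinearMap.congr_fun hs c
  let L : (κ → k) →ₗ[k] (ι → k) := τ.toLinearMap ∘ₗ s
  have hL : ∀ y, L (ρ y) = τ y := by
    intro y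
    have : τ (s (ρ y) - y) = 0 := hker _ (by rw [map_sub, hs', sub_self])
    rw [map_sub, sub_eq_zero] at this
    exact this
  have hLinj : Function.Injective L := by
    rw [LinearMap.injective_iff_surjective_of_finrank_eq_finrank (by simp [hcard])]
    intro c
    obtain ⟨y, rfl⟩ := hτ c
    exact ⟨ρ y, hL y⟩
  have hpow : ((LinearMap.ker ρ.toLinearMap).map ψ.symm.toAlgHom.toLinearMap) ^ N = ⊥ := by
    rw [← Submodule.map_pow, hN, Submodule.map_bot]
  refine isNilpotent_of_pow_eq_bot T (fun m => Submodule.mem_map.mpr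
    ⟨ψ (inr T m), ?_, ψ.symm_apply_apply _⟩) hpow
  change ρ (ψ (inr T m)) = 0
  apply hLinj
  rw [hL, map_zero]
  change π (fstHom k T (ψ.symm (ψ (inr T m)))) = 0
  rw [ψ.symm_apply_apply, fstHom_apply, fst_inr, map_zero]

end SplitExtension

section SplitQuotient

variable {k : Type w} [Field k] {Γ : Type u} [Ring Γ] [Algebra k Γ] {Λ : Type v} [Ring Λ]
  [Algebra k Λ]

theorem isSuperfluousSplitQuotient_of_section (g : Λ →ₐ[k] Γ) (s : Γ →ₐ[k] Λ)
    (hgs : ∀ y, g (s y) = y) (hg : ∀ y, g y = 0 → IsNilpotent y) :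
    IsSuperfluousSplitQuotient k Γ Λ := by
  let Φ : (Λ ⧸ RingHom.ker g) ≃ₐ[k] Γ :=
    Ideal.quotientKerAlgEquivOfSurjective (Function.RightInverse.surjective hgs)
  refine ⟨RingHom.ker g, inferInstance, le_jacobson_of_forall_isNilpotent _ hg,
    ⟨s.comp Φ.toAlgHom, fun y => Φ.injective ?_⟩, ⟨Φ.symm⟩⟩
  exact hgs (Φ y)

theorem IsArrowPreRemoval.isSuperfluousSplitQuotient (h : IsArrowPreRemoval k Γ Λ) :
    IsSuperfluousSplitQuotient k Γ Λ := by
  obtain ⟨B, ⟨ψ⟩, A, hA, ⟨φ⟩⟩ := h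
  let τ : B.algebra →ₐ[k] B.algebra :=
    Ideal.Quotient.liftₐ B.I ((Ideal.Quotient.mkₐ k B.I).comp ((killRealization k A).lift k))
      fun z hz => by
        rw [AlgHom.comp_apply, killRealization_lift]
        exact Ideal.Quotient.eq_zero_iff_mem.mpr (hA z hz).2
  have hτ : ∀ z, τ (Ideal.Quotient.mk B.I z) = Ideal.Quotient.mk B.I (avoiding A z) := by
    intro z
    rw [← killRealization_lift]
    rfl
  have hτA : B.arrowIdeal A ≤ RingHom.ker τ := by
    refine B.arrowIdeal_le A _ fun α hα => ?_
    rw [RingHom.mem_ker, hτ, avoiding_ofPath_of_passesThrough, map_zero]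
    exact ⟨α, hα, Quiver.Path.nil, Quiver.Path.nil, rfl⟩
  let s : (B.algebra ⧸ B.arrowIdeal A) →ₐ[k] B.algebra :=
    Ideal.Quotient.liftₐ (B.arrowIdeal A) τ fun y hy => hτA hy
  have hs : ∀ y, Ideal.Quotient.mk (B.arrowIdeal A) (s y) = y := by
    intro y
    obtain ⟨y, rfl⟩ := Ideal.Quotient.mk_surjective y
    obtain ⟨z, rfl⟩ := Ideal.Quotient.mk_surjective y
    change Ideal.Quotient.mk (B.arrowIdeal A) (τ (Ideal.Quotient.mk B.I z)) = _
    rw [hτ, eq_comm, Ideal.Quotient.eq, ← map_sub]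
    exact B.mk_sub_avoiding_mem_arrowIdeal A z
  have hproj : B.arrowIdeal A ≤ RingHom.ker B.proj := by
    refine B.arrowIdeal_le A _ fun α _ => ?_
    rw [RingHom.mem_ker, B.proj_mk, Realization.lift_ofPath]
    exact vertexRealization_eval_of_pos _ (by simp)
  obtain ⟨N, hN⟩ := B.exists_ker_proj_pow_eq_bot
  refine isSuperfluousSplitQuotient_of_section
    (φ.symm.toAlgHom.comp ((Ideal.Quotient.mkₐ k (B.arrowIdeal A)).comp ψ.toAlgHom))
    ((ψ.symm.toAlgHom.comp s).comp φ.toAlgHom) (fun y => ?_) fun y hy => ?_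
  · change φ.symm (Ideal.Quotient.mk (B.arrowIdeal A) (ψ (ψ.symm (s (φ y))))) = y
    rw [ψ.apply_symm_apply, hs, φ.symm_apply_apply]
  · have hy' : Ideal.Quotient.mk (B.arrowIdeal A) (ψ y) = 0 :=
      (map_eq_zero_iff _ φ.symm.injective).mp hy
    have hnil : IsNilpotent (ψ y) :=
      isNilpotent_of_mem_of_pow_eq_bot hN (hproj (Ideal.Quotient.eq_zero_iff_mem.mp hy'))
    exact (IsNilpotent.map_iff ψ.injective).mp hnil

end SplitQuotient

section KernelBimodule

variable {k : Type w} [Field k] {Γ : Type u} [Ring Γ] [Algebra k Γ] {Λ : Type v} [Ring Λ]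
  [Algebra k Λ] (g : Λ →ₐ[k] Γ) (s : Γ →ₐ[k] Λ)

/-- The kernel of a split epimorphism of algebras `g` with section `s`, as a `Γ`-bimodule. -/
def SplitKernel (g : Λ →ₐ[k] Γ) (_s : Γ →ₐ[k] Λ) : Type v := LinearMap.ker g.toLinearMap

namespace SplitKernel

variable {g s}

instance : AddCommGroup (SplitKernel g s) :=
  inferInstanceAs (AddCommGroup (LinearMap.ker g.toLinearMap))

instance : Module k (SplitKernel g s) :=
  inferInstanceAs (Module k (LinearMap.ker g.toLinearMap))

instance [Module.Finite k Λ] : Module.Finite k (SplitKernel g s) :=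
  inferInstanceAs (Module.Finite k (LinearMap.ker g.toLinearMap))

/-- The inclusion of the kernel. -/
def val (m : SplitKernel g s) : Λ := Subtype.val m

/-- An element of the kernel. -/
def mk (y : Λ) (hy : g y = 0) : SplitKernel g s := ⟨y, hy⟩

@[simp] theorem val_mk (y : Λ) (hy : g y = 0) : (mk y hy : SplitKernel g s).val = y := rfl

theorem apply_val (m : SplitKernel g s) : g m.val = 0 := m.2

@[ext] theorem ext {m n : SplitKernel g s} (h : m.val = n.val) : m = n := Subtype.ext h

@[simp] theorem val_add (m n : SplitKernel g s) : (m + n).val = m.val + n.val := rfl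
@[simp] theorem val_zero : (0 : SplitKernel g s).val = 0 := rfl
@[simp] theorem val_smul (c : k) (m : SplitKernel g s) : (c • m).val = c • m.val := rfl

instance : SMul Γ (SplitKernel g s) :=
  ⟨fun γ m => mk (s γ * m.val) (by rw [map_mul, m.apply_val, mul_zero])⟩

instance : SMul Γᵐᵒᵖ (SplitKernel g s) :=
  ⟨fun γ m => mk (m.val * s γ.unop) (by rw [map_mul, m.apply_val, zero_mul])⟩

@[simp] theorem val_left_smul (γ : Γ) (m : SplitKernel g s) : (γ • m).val = s γ * m.val := rfl

@[simp] theorem val_right_smul (γ : Γᵐᵒᵖ) (m : SplitKernel g s) :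
    (γ • m).val = m.val * s γ.unop := rfl

instance : Module Γ (SplitKernel g s) where
  one_smul _ := by ext; simp
  mul_smul _ _ _ := by ext; simp [mul_assoc]
  smul_zero _ := by ext; simp
  smul_add _ _ _ := by ext; simp [mul_add]
  add_smul _ _ _ := by ext; simp [add_mul]
  zero_smul _ := by ext; simp

instance : Module Γᵐᵒᵖ (SplitKernel g s) where
  one_smul _ := by ext; simp
  mul_smul _ _ _ := by ext; simp [mul_assoc]
  smul_zero _ := by ext; simp
  smul_add _ _ _ := by ext; simp [add_mul]
  add_smul _ _ _ := by ext; simp [mul_add]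
  zero_smul _ := by ext; simp

instance : SMulCommClass Γ Γᵐᵒᵖ (SplitKernel g s) :=
  ⟨fun _ _ _ => by ext; simp [mul_assoc]⟩

instance : IsScalarTower k Γ (SplitKernel g s) :=
  ⟨fun _ _ _ => by ext; simp⟩

instance : IsScalarTower k Γᵐᵒᵖ (SplitKernel g s) :=
  ⟨fun _ _ _ => by ext; simp⟩

variable (g s) in
/-- The multiplication of the kernel. -/
def mulBimodule : MultiplicativeBimodule Γ (SplitKernel g s) where
  θ := AddMonoidHom.mk' (fun m => AddMonoidHom.mk'
      (fun n => mk (m.val * n.val) (by rw [map_mul, m.apply_val, zero_mul]))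
      fun _ _ => by ext; simp [mul_add])
    fun _ _ => by ext; simp [add_mul]
  balanced _ _ _ := by ext; simp [mul_assoc]
  map_smul_left _ _ _ := by ext; simp [mul_assoc]
  map_smul_right _ _ _ := by ext; simp [mul_assoc]
  assoc _ _ _ := by ext; simp [mul_assoc]

@[simp] theorem val_mulBimodule_θ (m n : SplitKernel g s) :
    ((mulBimodule g s).θ m n).val = m.val * n.val := rfl

theorem val_iter_mem_pow (r : ℕ) (y : ℕ → SplitKernel g s) :
    ((mulBimodule g s).iter r y).val ∈ (LinearMap.ker g.toLinearMap) ^ (r + 1) := by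
  induction r with
  | zero => rw [zero_add, pow_one]; exact (y 0).2
  | succ r ih =>
    rw [pow_succ]
    exact Submodule.mul_mem_mul ih (y (r + 1)).2

theorem isNilpotent_mulBimodule {N : ℕ} (hN : (LinearMap.ker g.toLinearMap) ^ N = ⊥) :
    (mulBimodule g s).IsNilpotent := by
  refine ⟨N + 1, Nat.succ_pos N, fun y => SplitKernel.ext ?_⟩
  have := val_iter_mem_pow (N + 1) y
  rw [add_assoc, pow_add, hN, Submodule.bot_mul] at this
  exact (Submodule.mem_bot k).mp this

variable (g s) in
/-- The comparison homomorphism from the split extension by the kernel. -/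
def ofSplitExtension : SplitExtension (mulBimodule g s) →ₐ[k] Λ :=
  AlgHom.ofLinearMap
    { toFun := fun y => s y.1 + y.2.val
      map_add' := fun y z => by
        rw [SplitExtension.fst_add, SplitExtension.snd_add, map_add, val_add, add_add_add_comm]
      map_smul' := fun c y => by simp }
    (by simp)
    (fun y z => by
      simp only [LinearMap.coe_mk, AddHom.coe_mk, SplitExtension.fst_mul, SplitExtension.snd_mul,
        val_add, val_left_smul, val_right_smul, val_mulBimodule_θ, MulOpposite.unop_op, map_mul,
        mul_add, add_mul]
      abel)

theorem ofSplitExtension_apply (y : SplitExtension (mulBimodule g s)) :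
    ofSplitExtension g s y = s y.1 + y.2.val := rfl

theorem ofSplitExtension_bijective (hgs : ∀ y, g (s y) = y) :
    Function.Bijective (ofSplitExtension g s) := by
  constructor
  · rw [injective_iff_map_eq_zero]
    intro y hy
    rw [ofSplitExtension_apply] at hy
    have h₁ : y.1 = 0 := by
      have := congrArg g hy
      rwa [map_add, hgs, apply_val, add_zero, map_zero] at this
    refine SplitExtension.ext h₁ (SplitKernel.ext ?_)
    rwa [h₁, map_zero, zero_add] at hy
  · intro y
    refine ⟨(g y, mk (y - s (g y)) (by rw [map_sub, hgs, sub_self])), ?_⟩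
    exact add_sub_cancel _ _

end SplitKernel

theorem isNilpotentSplitExtension_of_section [Module.Finite k Λ] (hgs : ∀ y, g (s y) = y) {N : ℕ}
    (hN : (LinearMap.ker g.toLinearMap) ^ N = ⊥) : IsNilpotentSplitExtension k Γ Λ :=
  ⟨SplitKernel g s, inferInstance, inferInstance, inferInstance, inferInstance, inferInstance,
    inferInstance, inferInstance, inferInstance, SplitKernel.mulBimodule g s,
    SplitKernel.isNilpotent_mulBimodule hN,
    ⟨(AlgEquiv.ofBijective _ (SplitKernel.ofSplitExtension_bijective hgs)).symm⟩⟩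

theorem IsSuperfluousSplitQuotient.isNilpotentSplitExtension [Module.Finite k Λ]
    (h : IsSuperfluousSplitQuotient k Γ Λ) : IsNilpotentSplitExtension k Γ Λ := by
  obtain ⟨K, hK, hKJ, ⟨s, hs⟩, ⟨φ⟩⟩ := h
  let g : Λ →ₐ[k] Γ := φ.symm.toAlgHom.comp (Ideal.Quotient.mkₐ k K)
  have hg : LinearMap.ker g.toLinearMap ≤ (Ring.jacobson Λ).restrictScalars k := by
    intro y hy
    have hy' : Ideal.Quotient.mk K y = 0 := (map_eq_zero_iff _ φ.symm.injective).mp hy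
    exact hKJ (Ideal.Quotient.eq_zero_iff_mem.mp hy')
  obtain ⟨N, hN⟩ := exists_pow_eq_bot_of_le_jacobson hg
  refine isNilpotentSplitExtension_of_section g (s.comp φ.toAlgHom) (fun y => ?_) hN
  change φ.symm (Ideal.Quotient.mk K (s (φ y))) = y
  rw [hs, φ.symm_apply_apply]

theorem IsNilpotentSplitExtension.isArrowPreRemoval (hΓ : IsBasicWithOneDimSimples k Γ)
    (h : IsNilpotentSplitExtension k Γ Λ) : IsArrowPreRemoval k Γ Λ := by
  have := hΓ.finite
  obtain ⟨M, _, _, _, _, _, _, _, _, T, hT, ⟨ψ⟩⟩ := h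
  obtain ⟨n, hn⟩ := isSplitBasic_of_finrank_simple_eq_one hΓ.finrank_simple
  obtain ⟨C, -, ⟨φ⟩, hA⟩ := SplitExtension.exists_boundQuiver T hn hT
  exact ⟨C, ⟨ψ.trans φ⟩, hA⟩

end KernelBimodule

theorem mainTheorem8 {k : Type w} [Field k] :
    (∀ (B : BoundQuiver.{u, v, w} k) (M : Type x) [AddCommGroup M] [Module k M]
        [Module B.algebra M] [Module B.algebraᵐᵒᵖ M] [SMulCommClass B.algebra B.algebraᵐᵒᵖ M]
        [IsScalarTower k B.algebra M] [IsScalarTower k B.algebraᵐᵒᵖ M] [Module.Finite k M]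
        (T : MultiplicativeBimodule B.algebra M),
        ((∃ C : BoundQuiver.{0, 0, w} k, Fintype.card C.V = Fintype.card B.V ∧
            Nonempty (SplitExtension T ≃ₐ[k] C.algebra)) ↔ T.IsNilpotent) ∧
        (T.IsNilpotent → IsArrowPreRemoval k B.algebra (SplitExtension T))) ∧
    (∀ (Γ : Type u) [Ring Γ] [Algebra k Γ] (Λ : Type v) [Ring Λ] [Algebra k Λ],
        IsBasicWithOneDimSimples k Γ → IsBasicWithOneDimSimples k Λ →
        [IsArrowPreRemoval k Γ Λ, IsSuperfluousSplitQuotient k Γ Λ,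
          IsNilpotentSplitExtension k Γ Λ].TFAE) := by
  refine ⟨fun B M _ _ _ _ _ _ _ _ T => ?_, fun Γ _ _ Λ _ _ hΓ hΛ => ?_⟩
  · have hB : IsSplitBasic k (Fin (Fintype.card B.V)) B.algebra :=
      B.isSplitBasic.of_equiv_index (Fintype.equivFin B.V)
    refine ⟨⟨?_, fun hT => ?_⟩, fun hT => ?_⟩
    · rintro ⟨C, hcard, ⟨ψ⟩⟩
      exact SplitExtension.isNilpotent_of_equiv T B.isSplitBasic C.isSplitBasic hcard ψ
    · obtain ⟨C, hcard, hC, -⟩ := SplitExtension.exists_boundQuiver T hB hT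
      exact ⟨C, hcard.trans (Fintype.card_fin _), hC⟩
    · obtain ⟨C, -, hC, hA⟩ := SplitExtension.exists_boundQuiver T hB hT
      exact ⟨C, hC, hA⟩
  · have := hΛ.finite
    tfae_have 1 → 2 := IsArrowPreRemoval.isSuperfluousSplitQuotient
    tfae_have 2 → 3 := IsSuperfluousSplitQuotient.isNilpotentSplitExtension
    tfae_have 3 → 1 := IsNilpotentSplitExtension.isArrowPreRemoval hΓ
    tfae_finish
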